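/- **Setting.** Let $N_1,N_2$ be compact finite-dimensional Riemannian manifolds (possibly with boundary), $\operatorname{diam}N_2=1$, let $m_1$ be the Riemannian volume of $N_1$ normalized to total mass $1$, $\Sigma=N_1\times N_2$, and let $F(x,y)=(T(x),G(x,y))$ with $T:N_1\to N_1$ and $G:\Sigma\to N_2$ Borel measurable. Assumptions: * **G1**: there is $0<\alpha<1$ with $d_2(G(x,y_1),G(x,y_2))\le\alpha\, d_2(y_1,y_2)$ for all $x\in N_1$ and $y_1,y_2\in N_2$. * **T1**: $m_1(A)=0$ implies $m_1(T^{-1}A)=0$. * **T2**: there are finitely many pairwise disjoint open sets $P_1,\dots,P_q\subseteq N_1$ with $m_1(\bigcup_i P_i)=1$ such that each $T|_{P_i}$ is a $C^1$ diffeomorphism onto its image and $\det DT\ne0$ on $P_i$. * **T3**: let $\mathrm P_T:L^1(m_1)\to L^1(m_1)$ be the Perron–Frobenius operator of $T$, so that $\int\psi\,\mathrm P_T\phi\,dm_1=\int(\psi\circ T)\,\phi\,dm_1$ for $\phi\in L^1(m_1)$, $\psi\in L^\infty(m_1)$. There is a real Banach space $(S_-,|\cdot|_s)$, $S_-\subseteq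 L^1(m_1)$, that contains the constant function $1$ and satisfies: * **T3.1**: $|\cdot|_1\le|\cdot|_s$ on $S_-$, and $\mathrm P_T$ maps $S_-$ boundedly into itself; * **T3.2**: the unit ball of $S_-$ is relatively compact in $L^1(m_1)$; * **T3.3**: there are $k\in\mathbb N$, $0<\beta_0<1$, $C>0$ with $|\mathrm P_T^kf|_s\le\beta_0|f|_s+C|f|_1$ for all $f\in S_-$; * **T3.4**: there is a unique $\psi_x\in S_-$ with $\psi_x\ge0$, $|\psi_x|_1=1$ and $\mathrm P_T\psi_x=\psi_x$, and $\mathrm P_T^n(\psi_x-\psi)\to0$ in $S_-$ for every $\psi\in S_-$ with $\psi\ge0$ and $|\psi|_1=1$. * **N1**: there is $H_N\ge0$ with $|f|_\infty\le H_N|f|_s$ for all $f\in S_-$. **The space $S^\infty$.** For finite positive Borel measures $\mu,\nu$ on $N_2$ let $W_1^0(\mu,\nu)=\sup|\int g\,d\mu-\int g\,d\nu|$ over all $g:N_2\to\mathbb R$ with Lipschitz constant at most $1$ and $\|g\|_\infty\le1$. Let $\mathcal{AB}$ be the set of finite signed Borel measures $\mu$ on $\Sigma$ such that the marginals on $N_1$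 of the parts $\mu^\pm$ of its Jordan decomposition are absolutely continuous with respect to $m_1$; let $\phi_x^\pm$ be the densities of these marginals and $\phi_x=\phi_x^+-\phi_x^-$. For $\gamma\in N_1$ let $\mu^\pm|_\gamma$ be the measure on $N_2$ given by $\phi_x^\pm(\gamma)$ times the conditional probability of $\mu^\pm$ on $\{\gamma\}\times N_2$. Put $\|\mu\|_\infty=\operatorname{ess\,sup}_{\gamma\in N_1}W_1^0(\mu^+|_\gamma,\mu^-|_\gamma)$ (with respect to $m_1$), $$S^\infty=\{\mu\in\mathcal{AB}:\|\mu\|_\infty<\infty,\ \phi_x\in S_-\},\qquad \|\mu\|_{S^\infty}=|\phi_x|_s+\|\mu\|_\infty .$$ Let $[F^*\mu](E)=\mu(F^{-1}(E))$. **Theorem (spectral gap on $S^\infty$).** Under these assumptions $F^*$ maps $S^\infty$ linearly into itself, and there are linear operators $P,N:S^\infty\to S^\infty$ with $F^*=P+N$ such that * (a) $P$ is a bounded projection ($P^2=P$) and $\dim\operatorname{Im}P=1$; * (b) there are $0<\xi_1<1$ and $K_2>0$ with $\|N^n\mu\|_{S^\infty}\le K_2\,\xi_1^n\,\|\mu\|_{S^\infty}$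 for all $\mu\in S^\infty$ and all integers $n\ge0$; * (c) $PN=NP=0$. -/

import Mathlib

open MeasureTheory ProbabilityTheory Set Filter Topology Bundle
open scoped ENNReal NNReal Manifold ContDiff

set_option linter.unusedSectionVars false

noncomputable section

namespace SkewProduct

/-! ### Riemannian volume -/

section Riemannian

variable {d : ℕ} {H : Type*} [TopologicalSpace H]
  (I : ModelWithCorners ℝ (EuclideanSpace ℝ (Fin d)) H)
  {M : Type*} [TopologicalSpace M] [ChartedSpace H M] [IsManifold I ∞ M]
  [RiemannianBundle (fun x : M => TangentSpace I x)]

/-- The Gram determinant `det (⟨vᵢ, vⱼ⟩)` of tangent vectors `v₁, …, v_d` at `p`. -/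
def gramDet (p : M) (v : Fin d → TangentSpace I p) : ℝ :=
  Matrix.det (Matrix.of fun i j => inner ℝ (v i) (v j))

/-- The `i`-th coordinate vector field of the chart around `x`, at the point with coordinates
`e`. -/
def coordVector (x : M) (e : EuclideanSpace ℝ (Fin d)) (i : Fin d) :
    TangentSpace I ((extChartAt I x).symm e) :=
  mfderivWithin 𝓘(ℝ, EuclideanSpace ℝ (Fin d)) I (extChartAt I x).symm (range I) e
    (EuclideanSpace.basisFun (Fin d) ℝ i)

/-- The measure `√(det g) dx` of the chart around `x`, carried to the manifold. -/
def chartVolume [MeasurableSpace M] (x : M) : Measure M :=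
  ((volume.restrict (extChartAt I x).target).withDensity fun e =>
    ENNReal.ofReal (Real.sqrt (gramDet I ((extChartAt I x).symm e) (coordVector I x e)))).map
      (extChartAt I x).symm

/-- The Riemannian volume. The measures of two charts agree on the overlap of their domains, and
the volume is the smallest measure that dominates all of them; on the domain of each chart it is
`√(det g) dx`. -/
def riemannianVolume (M : Type*) [TopologicalSpace M] [ChartedSpace H M] [IsManifold I ∞ M]
    [RiemannianBundle (fun x : M => TangentSpace I x)] [MeasurableSpace M] : Measure M :=
  ⨆ x : M, chartVolume I x

/-- The Riemannian volume, normalized to total mass one. -/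
def normalizedVolume (M : Type*) [TopologicalSpace M] [ChartedSpace H M] [IsManifold I ∞ M]
    [RiemannianBundle (fun x : M => TangentSpace I x)] [MeasurableSpace M] : Measure M :=
  (riemannianVolume I M univ)⁻¹ • riemannianVolume I M

instance (M : Type*) [TopologicalSpace M] [ChartedSpace H M] [IsManifold I ∞ M]
    [RiemannianBundle (fun x : M => TangentSpace I x)] [MeasurableSpace M] :
    IsFiniteMeasure (normalizedVolume I M) := by
  unfold normalizedVolume; infer_instance

/-- `|det DT(x)|` with respect to the Riemannian metric: the factor by which the differential of
`T` at `x` multiplies the volume of parallelepipeds. -/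
def absJacobian (T : M → M) (x : M) : ℝ :=
  Real.sqrt (gramDet I (T x) fun i =>
      mfderiv I I T x (EuclideanSpace.basisFun (Fin d) ℝ i : EuclideanSpace ℝ (Fin d))) /
    Real.sqrt (gramDet I x fun i =>
      (EuclideanSpace.basisFun (Fin d) ℝ i : EuclideanSpace ℝ (Fin d)))

/-- There are finitely many pairwise disjoint open sets of full measure, on each of which `T` is a
`C¹` diffeomorphism onto its image with non-vanishing Jacobian determinant. -/
def IsPiecewiseDiffeo [MeasurableSpace M] (m : Measure M) (T : M → M) : Prop :=
  ∃ (q : ℕ) (P : Fin q → Set M),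
    (∀ i, IsOpen (P i)) ∧ (∀ i j, i ≠ j → Disjoint (P i) (P j)) ∧ m (⋃ i, P i) = 1 ∧
    ∀ i, ContMDiffOn I I 1 T (P i) ∧
      (∃ R : M → M, ContMDiffOn I I 1 R (T '' P i) ∧ ∀ x ∈ P i, R (T x) = x) ∧
      ∀ x ∈ P i, absJacobian I T x ≠ 0

end Riemannian

/-! ### The base map and its Perron-Frobenius operator -/

section Base

variable {X : Type*} [MeasurableSpace X]

/-- The density with respect to `m` of the image under `T` of the positive measure `φ⁺ m`. -/
def pushDensity (m : Measure X) (T : X → X) (φ : X → ℝ) (x : X) : ℝ :=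
  (((m.withDensity fun y => ENNReal.ofReal (φ y)).map T).rnDeriv m x).toReal

lemma integrable_pushDensity (m : Measure X) (T : X → X) {φ : X → ℝ} (hφ : Integrable φ m) :
    Integrable (pushDensity m T φ) m := by
  have : IsFiniteMeasure (m.withDensity fun y => ENNReal.ofReal (φ y)) :=
    isFiniteMeasure_withDensity_ofReal hφ.2
  exact Measure.integrable_toReal_rnDeriv

/-- The Perron-Frobenius operator of `T` on `L¹(m)`: `P_T φ` is the density of `T_*(φ m)`. -/
def perronFrobenius (m : Measure X) (T : X → X) (φ : X →₁[m] ℝ) : X →₁[m] ℝ :=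
  (integrable_pushDensity m T (L1.integrable_coeFn φ)).toL1 _ -
    (integrable_pushDensity m T (L1.integrable_coeFn φ).neg).toL1 _

lemma integral_mul_pushDensity (m : Measure X) [SigmaFinite m] {T : X → X}
    (hT : Measure.QuasiMeasurePreserving T m m) {φ ψ : X → ℝ} (hφ : Integrable φ m)
    (hψ : Measurable ψ) :
    ∫ x, ψ x * pushDensity m T φ x ∂m = ∫ x, ψ (T x) * max (φ x) 0 ∂m := by
  have : IsFiniteMeasure (m.withDensity fun y => ENNReal.ofReal (φ y)) :=
    isFiniteMeasure_withDensity_ofReal hφ.2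
  set ν := (m.withDensity fun y => ENNReal.ofReal (φ y)) with hν
  have hac : ν.map T ≪ m :=
    ((withDensity_absolutelyContinuous m _).map hT.measurable).trans hT.absolutelyContinuous
  have h1 : ∫ x, ψ x * pushDensity m T φ x ∂m = ∫ x, ψ x ∂(ν.map T) := by
    rw [← integral_rnDeriv_smul hac]
    refine integral_congr_ae (Eventually.of_forall fun x => ?_)
    simp [pushDensity, hν, mul_comm]
  rw [h1, integral_map hT.measurable.aemeasurable hψ.aestronglyMeasurable, hν,
    integral_withDensity_eq_integral_toReal_smul₀ hφ.aemeasurable.ennreal_ofReal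
      (Eventually.of_forall fun x => ENNReal.ofReal_lt_top)]
  refine integral_congr_ae (Eventually.of_forall fun x => ?_)
  simp [ENNReal.toReal_ofReal', mul_comm]

/-- `P_T` is characterized by the duality `∫ ψ · P_T φ = ∫ (ψ ∘ T) · φ` for bounded `ψ`. -/
lemma integral_mul_perronFrobenius (m : Measure X) [SigmaFinite m] {T : X → X}
    (hT : Measure.QuasiMeasurePreserving T m m) (φ : X →₁[m] ℝ) {ψ : X → ℝ}
    (hψ : Measurable ψ) {c : ℝ} (hc : ∀ x, |ψ x| ≤ c) :
    ∫ x, ψ x * perronFrobenius m T φ x ∂m = ∫ x, ψ (T x) * φ x ∂m := by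
  have hφ := L1.integrable_coeFn φ
  have hb : ∀ {f : X → ℝ}, Integrable f m → Integrable (fun x => ψ x * f x) m := fun hf =>
    hf.bdd_mul hψ.aestronglyMeasurable (Eventually.of_forall hc)
  have hb' : ∀ {f : X → ℝ}, Integrable f m → Integrable (fun x => ψ (T x) * f x) m := fun hf =>
    hf.bdd_mul (hψ.comp hT.measurable).aestronglyMeasurable
      (Eventually.of_forall fun x => hc (T x))
  have h1 : ∫ x, ψ x * perronFrobenius m T φ x ∂m =
      ∫ x, (ψ x * pushDensity m T φ x - ψ x * pushDensity m T (-φ) x) ∂m := by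
    refine integral_congr_ae ?_
    filter_upwards [Lp.coeFn_sub ((integrable_pushDensity m T hφ).toL1 _)
      ((integrable_pushDensity m T hφ.neg).toL1 _),
      (integrable_pushDensity m T hφ).coeFn_toL1,
      (integrable_pushDensity m T hφ.neg).coeFn_toL1] with x h h' h''
    simp only [perronFrobenius]
    rw [h, Pi.sub_apply, h', h'', mul_sub]
  rw [h1, integral_sub (hb (integrable_pushDensity m T hφ)) (hb (integrable_pushDensity m T hφ.neg)),
    integral_mul_pushDensity m hT hφ hψ, integral_mul_pushDensity m hT hφ.neg hψ,
    ← integral_sub (hb' hφ.pos_part) (hb' hφ.neg.pos_part)]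
  refine integral_congr_ae (Eventually.of_forall fun x => ?_)
  simp only [Pi.neg_apply]
  rw [← mul_sub]
  congr 1
  rcases le_total 0 (φ x) with h | h
  · rw [max_eq_left h, max_eq_right (by linarith)]; ring
  · rw [max_eq_right h, max_eq_left (by linarith)]; ring

/-- `φ` is the density of a probability measure. -/
def IsDensity {m : Measure X} (φ : X →₁[m] ℝ) : Prop := 0 ≤ᵐ[m] φ ∧ ‖φ‖ = 1

/-- The assumptions on the functional analytic setting of the base map. The Banach space `S`
is a linear subspace of `L¹(m)` with a norm of its own: `ι` is the inclusion. The bounded operator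
`PS` is the restriction of the Perron-Frobenius operator to `S`. -/
structure IsStrongSpace {m : Measure X} (T : X → X) {S : Type*} [NormedAddCommGroup S]
    [NormedSpace ℝ S] (ι : S →ₗ[ℝ] (X →₁[m] ℝ)) (PS : S →L[ℝ] S) : Prop where
  injective : Function.Injective ι
  norm_le : ∀ f, ‖ι f‖ ≤ ‖f‖
  invariant : ∀ f, ι (PS f) = perronFrobenius m T (ι f)
  relativelyCompact : IsCompact (closure (ι '' Metric.closedBall 0 1))
  lasotaYorke : ∃ (k : ℕ) (β C : ℝ), 0 < β ∧ β < 1 ∧ 0 < C ∧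
    ∀ f, ‖(PS ^ k) f‖ ≤ β * ‖f‖ + C * ‖ι f‖
  equilibrium : ∃ ψ₀ : S, (IsDensity (ι ψ₀) ∧ PS ψ₀ = ψ₀) ∧
    (∀ ψ, IsDensity (ι ψ) ∧ PS ψ = ψ → ψ = ψ₀) ∧
    ∀ ψ, IsDensity (ι ψ) → Tendsto (fun n : ℕ => (PS ^ n) (ψ₀ - ψ)) atTop (𝓝 0)

/-- The norm of `S` dominates the `L^∞` norm. -/
def DominatesLInf {m : Measure X} {S : Type*} [NormedAddCommGroup S] [NormedSpace ℝ S]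
    (ι : S →ₗ[ℝ] (X →₁[m] ℝ)) : Prop :=
  ∃ C : ℝ, 0 ≤ C ∧ ∀ f, eLpNorm (ι f) ∞ m ≤ ENNReal.ofReal (C * ‖f‖)

end Base

/-! ### Disintegration along the vertical leaves and the anisotropic space -/

section Measures

variable {X Y : Type*} [MeasurableSpace X] [MetricSpace Y] [CompactSpace Y] [MeasurableSpace Y]
  [BorelSpace Y]

/-- The Wasserstein-Kantorovich like distance: the supremum of `|∫ g dμ - ∫ g dν|` over `g` with
`L(g) ≤ 1` and `‖g‖_∞ ≤ 1`. -/
def wDist (μ ν : Measure Y) : ℝ≥0∞ :=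
  ⨆ g : {g : Y → ℝ // LipschitzWith 1 g ∧ ∀ y, |g y| ≤ 1},
    ENNReal.ofReal |∫ y, g.1 y ∂μ - ∫ y, g.1 y ∂ν|

variable [Nonempty Y]

/-- The restriction of the positive measure `μ` to the leaf `{γ} × Y`, as a measure on `Y`:
the marginal density at `γ` times the conditional probability on the leaf. -/
def leafRestrict (m : Measure X) (μ : Measure (X × Y)) [IsFiniteMeasure μ] (γ : X) : Measure Y :=
  μ.fst.rnDeriv m γ • μ.condKernel γ

/-- Signed measures on `X × Y` whose positive and negative parts have absolutely continuous
marginals. -/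
def AB (m : Measure X) : Set (SignedMeasure (X × Y)) :=
  {μ | μ.toJordanDecomposition.posPart.fst ≪ m ∧ μ.toJordanDecomposition.negPart.fst ≪ m}

/-- `γ ↦ W(μ⁺|γ, μ⁻|γ)`. -/
def leafNorm (m : Measure X) (μ : SignedMeasure (X × Y)) (γ : X) : ℝ≥0∞ :=
  wDist (leafRestrict m μ.toJordanDecomposition.posPart γ)
    (leafRestrict m μ.toJordanDecomposition.negPart γ)

/-- `‖μ‖_∞`, the essential supremum of the leafwise norms. -/
def lInfNorm (m : Measure X) (μ : SignedMeasure (X × Y)) : ℝ≥0∞ := essSup (leafNorm m μ) m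

/-- The marginal density `φ_x = φ_x⁺ - φ_x⁻` of a signed measure. -/
def marginalDensity (m : Measure X) (μ : SignedMeasure (X × Y)) : X →₁[m] ℝ :=
  (Measure.integrable_toReal_rnDeriv (μ := μ.toJordanDecomposition.posPart.fst) (ν := m)).toL1 _ -
    (Measure.integrable_toReal_rnDeriv (μ := μ.toJordanDecomposition.negPart.fst) (ν := m)).toL1 _

/-! The following facts are used to show that `S^∞` is a vector space. -/

lemma ae_eq_of_setLIntegral_eq {Z : Type*} [MeasurableSpace Z]
    [MeasurableSpace.CountablyGenerated Z] (m : Measure X) [SigmaFinite m] {κ η : X → Measure Z}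
    (hκ : ∀ B, MeasurableSet B → Measurable fun x => κ x B)
    (hη : ∀ B, MeasurableSet B → Measurable fun x => η x B)
    (hf : ∀ᵐ x ∂m, κ x univ < (⊤ : ℝ≥0∞))
    (h : ∀ A B, MeasurableSet A → MeasurableSet B →
      ∫⁻ x in A, κ x B ∂m = ∫⁻ x in A, η x B ∂m) :
    ∀ᵐ x ∂m, κ x = η x := by
  set C := generateSetAlgebra (MeasurableSpace.countableGeneratingSet Z) with hC
  have hCc : C.Countable :=
    countable_generateSetAlgebra (MeasurableSpace.countable_countableGeneratingSet (α := Z))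
  have hgen : ‹MeasurableSpace Z› = MeasurableSpace.generateFrom C := by
    rw [hC, generateFrom_generateSetAlgebra_eq,
      MeasurableSpace.generateFrom_countableGeneratingSet]
  have hmeas : ∀ B ∈ C, MeasurableSet B := fun B hB => by
    rw [hgen]; exact MeasurableSpace.measurableSet_generateFrom hB
  have hae : ∀ B, MeasurableSet B → ∀ᵐ x ∂m, κ x B = η x B := fun B hB =>
    ae_eq_of_forall_setLIntegral_eq_of_sigmaFinite (hκ B hB) (hη B hB) fun A hA _ => h A B hA hB
  have hall : ∀ᵐ x ∂m, ∀ B ∈ C, κ x B = η x B :=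
    (ae_ball_iff hCc).2 fun B hB => hae B (hmeas B hB)
  filter_upwards [hf, hall, hae univ MeasurableSet.univ] with x hx h1 h2
  have : IsFiniteMeasure (κ x) := ⟨hx⟩
  exact ext_of_generate_finite C hgen
    (fun s hs t ht _ => isSetAlgebra_generateSetAlgebra.inter_mem hs ht) h1 h2

section

variable (m : Measure X)

lemma measurable_leafRestrict (p : Measure (X × Y)) [IsFiniteMeasure p] {B : Set Y}
    (hB : MeasurableSet B) : Measurable fun x => leafRestrict m p x B := by
  simp only [leafRestrict, Measure.smul_apply, smul_eq_mul]
  exact (Measure.measurable_rnDeriv _ _).mul (Kernel.measurable_coe _ hB)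

lemma setLIntegral_leafRestrict [IsFiniteMeasure m] {p : Measure (X × Y)} [IsFiniteMeasure p] (hp : p.fst ≪ m)
    {A : Set X} {B : Set Y} (hA : MeasurableSet A) (hB : MeasurableSet B) :
    ∫⁻ x in A, leafRestrict m p x B ∂m = p (A ×ˢ B) := by
  simp only [leafRestrict, Measure.smul_apply, smul_eq_mul]
  rw [setLIntegral_rnDeriv_mul hp (Kernel.measurable_coe _ hB).aemeasurable hA,
    Measure.setLIntegral_condKernel_eq_measure_prod hA hB]

lemma leafRestrict_univ (p : Measure (X × Y)) [IsFiniteMeasure p] (x : X) :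
    leafRestrict m p x univ = p.fst.rnDeriv m x := by
  simp [leafRestrict]

lemma leafRestrict_univ_lt_top [IsFiniteMeasure m] (p : Measure (X × Y)) [IsFiniteMeasure p] :
    ∀ᵐ x ∂m, leafRestrict m p x univ < (⊤ : ℝ≥0∞) := by
  filter_upwards [Measure.rnDeriv_lt_top p.fst m] with x hx
  rwa [leafRestrict_univ]

lemma leafRestrict_add [IsFiniteMeasure m] {p r : Measure (X × Y)} [IsFiniteMeasure p] [IsFiniteMeasure r]
    (hp : p.fst ≪ m) (hr : r.fst ≪ m) :
    ∀ᵐ x ∂m, leafRestrict m (p + r) x = leafRestrict m p x + leafRestrict m r x := by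
  have hpr : (p + r).fst ≪ m := by
    rw [Measure.fst_add]; exact Measure.AbsolutelyContinuous.add_left hp hr
  refine ae_eq_of_setLIntegral_eq m (fun B hB => measurable_leafRestrict m _ hB) (fun B hB => ?_)
    (leafRestrict_univ_lt_top m _) (fun A B hA hB => ?_)
  · simp only [Measure.add_apply]
    exact (measurable_leafRestrict m _ hB).add (measurable_leafRestrict m _ hB)
  · simp only [Measure.add_apply]
    rw [lintegral_add_left (measurable_leafRestrict m _ hB), setLIntegral_leafRestrict m hpr hA hB,
      setLIntegral_leafRestrict m hp hA hB, setLIntegral_leafRestrict m hr hA hB]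
    rfl

lemma leafRestrict_smul [IsFiniteMeasure m] (c : ℝ≥0) {p : Measure (X × Y)} [IsFiniteMeasure p] (hp : p.fst ≪ m) :
    ∀ᵐ x ∂m, leafRestrict m (c • p) x = c • leafRestrict m p x := by
  have hcp : (c • p).fst ≪ m := by
    rw [Measure.fst, Measure.map_smul]; exact hp.smul_left c
  refine ae_eq_of_setLIntegral_eq m (fun B hB => measurable_leafRestrict m _ hB) (fun B hB => ?_)
    (leafRestrict_univ_lt_top m _) (fun A B hA hB => ?_)
  · simp only [Measure.smul_apply]
    exact (measurable_leafRestrict m _ hB).const_smul c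
  · have e : ∀ x, (c • leafRestrict m p x) B = (c : ℝ≥0∞) * leafRestrict m p x B := fun x => rfl
    simp only [e]
    rw [lintegral_const_mul _ (measurable_leafRestrict m _ hB),
      setLIntegral_leafRestrict m hcp hA hB, setLIntegral_leafRestrict m hp hA hB]
    rfl

lemma wDist_comm (p q : Measure Y) : wDist p q = wDist q p := by
  simp only [wDist, abs_sub_comm]

lemma integrable_of_bound (p : Measure Y) [IsFiniteMeasure p]
    (g : {g : Y → ℝ // LipschitzWith 1 g ∧ ∀ y, |g y| ≤ 1}) : Integrable g.1 p :=
  Integrable.of_bound g.2.1.continuous.measurable.aestronglyMeasurable 1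
    (Eventually.of_forall g.2.2)

lemma wDist_congr {p q r s : Measure Y} [IsFiniteMeasure p] [IsFiniteMeasure q]
    [IsFiniteMeasure r] [IsFiniteMeasure s] (h : p + s = r + q) : wDist p q = wDist r s := by
  refine iSup_congr fun g => ?_
  have := congrArg (fun μ : Measure Y => ∫ y, g.1 y ∂μ) h
  rw [integral_add_measure (integrable_of_bound p g) (integrable_of_bound s g),
    integral_add_measure (integrable_of_bound r g) (integrable_of_bound q g)] at this
  congr 2
  linarith

lemma wDist_add_le (p q r s : Measure Y) [IsFiniteMeasure p] [IsFiniteMeasure q]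
    [IsFiniteMeasure r] [IsFiniteMeasure s] :
    wDist (p + r) (q + s) ≤ wDist p q + wDist r s := by
  refine iSup_le fun g => ?_
  rw [integral_add_measure (integrable_of_bound p g) (integrable_of_bound r g),
    integral_add_measure (integrable_of_bound q g) (integrable_of_bound s g), add_sub_add_comm]
  refine (ENNReal.ofReal_le_ofReal (abs_add_le _ _)).trans ?_
  rw [ENNReal.ofReal_add (abs_nonneg _) (abs_nonneg _)]
  exact add_le_add (le_iSup_of_le g le_rfl) (le_iSup_of_le g le_rfl)

lemma wDist_smul (c : ℝ≥0) (p q : Measure Y) : wDist (c • p) (c • q) = c * wDist p q := by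
  rw [wDist, wDist, ENNReal.mul_iSup]
  refine iSup_congr fun g => ?_
  rw [integral_smul_nnreal_measure, integral_smul_nnreal_measure, ← smul_sub, NNReal.smul_def,
    smul_eq_mul, abs_mul, ENNReal.ofReal_mul (abs_nonneg _), NNReal.abs_eq,
    ENNReal.ofReal_coe_nnreal]

/-- If `μ = p - q` for finite positive measures `p` and `q`, not necessarily mutually singular,
then the notions above can be computed from `p` and `q`. -/
lemma repr_aux [IsFiniteMeasure m] {μ : SignedMeasure (X × Y)} {p q : Measure (X × Y)}
    [IsFiniteMeasure p] [IsFiniteMeasure q] (h : μ = p.toSignedMeasure - q.toSignedMeasure)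
    (hp : p.fst ≪ m) (hq : q.fst ≪ m) :
    μ ∈ AB m ∧
    (∀ᵐ x ∂m, leafNorm m μ x = wDist (leafRestrict m p x) (leafRestrict m q x)) ∧
    ∀ᵐ x ∂m, marginalDensity m μ x = (p.fst.rnDeriv m x).toReal - (q.fst.rnDeriv m x).toReal := by
  set a := μ.toJordanDecomposition.posPart with ha
  set b := μ.toJordanDecomposition.negPart with hb
  have hμ : μ = a.toSignedMeasure - b.toSignedMeasure :=
    μ.toSignedMeasure_toJordanDecomposition.symm
  have hsum : a + q = p + b := by
    have h1 : a.toSignedMeasure + q.toSignedMeasure = p.toSignedMeasure + b.toSignedMeasure := by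
      have := hμ.symm.trans h
      rw [sub_eq_sub_iff_add_eq_add] at this
      exact this
    rw [← Measure.toSignedMeasure_add, ← Measure.toSignedMeasure_add] at h1
    exact Measure.toSignedMeasure_eq_toSignedMeasure_iff.1 h1
  obtain ⟨S, hS, hS1, hS2⟩ := μ.toJordanDecomposition.mutuallySingular
  rw [← ha] at hS1
  rw [← hb] at hS2
  have hap : a ≤ p := by
    refine Measure.le_iff.2 fun A hA => ?_
    have h1 : a A = a (A ∩ Sᶜ) := by
      rw [← measure_inter_add_sdiff A hS, measure_mono_null inter_subset_right hS1, zero_add]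
      rfl
    have h2 : b (A ∩ Sᶜ) = 0 := measure_mono_null inter_subset_right hS2
    calc a A = a (A ∩ Sᶜ) := h1
      _ ≤ (a + q) (A ∩ Sᶜ) := by rw [Measure.add_apply]; exact le_self_add
      _ = p (A ∩ Sᶜ) := by rw [hsum, Measure.add_apply, h2, add_zero]
      _ ≤ p A := measure_mono inter_subset_left
  have hbq : b ≤ q := by
    refine Measure.le_iff.2 fun A hA => ?_
    have h1 : b A = b (A ∩ S) := by
      rw [← measure_inter_add_sdiff A hS]
      have : b (A \ S) = 0 := measure_mono_null (fun x hx => hx.2) hS2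
      rw [this, add_zero]
    have h2 : a (A ∩ S) = 0 := measure_mono_null inter_subset_right hS1
    calc b A = b (A ∩ S) := h1
      _ ≤ (p + b) (A ∩ S) := by rw [Measure.add_apply]; exact le_add_self
      _ = q (A ∩ S) := by rw [← hsum, Measure.add_apply, h2, zero_add]
      _ ≤ q A := measure_mono inter_subset_left
  have ha' : a.fst ≪ m :=
    (Measure.absolutelyContinuous_of_le (Measure.map_mono hap measurable_fst)).trans hp
  have hb' : b.fst ≪ m :=
    (Measure.absolutelyContinuous_of_le (Measure.map_mono hbq measurable_fst)).trans hq
  have key : ∀ᵐ x ∂m, leafRestrict m a x + leafRestrict m q x =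
      leafRestrict m p x + leafRestrict m b x := by
    filter_upwards [leafRestrict_add m ha' hq, leafRestrict_add m hp hb'] with x h1 h2
    rw [← h1, ← h2]
    simp only [hsum]
  refine ⟨⟨ha', hb'⟩, ?_, ?_⟩
  · filter_upwards [key, leafRestrict_univ_lt_top m a, leafRestrict_univ_lt_top m b,
      leafRestrict_univ_lt_top m p, leafRestrict_univ_lt_top m q] with x h1 h2 h3 h4 h5
    have : IsFiniteMeasure (leafRestrict m a x) := ⟨h2⟩
    have : IsFiniteMeasure (leafRestrict m b x) := ⟨h3⟩
    have : IsFiniteMeasure (leafRestrict m p x) := ⟨h4⟩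
    have : IsFiniteMeasure (leafRestrict m q x) := ⟨h5⟩
    exact wDist_congr h1
  · filter_upwards [key, leafRestrict_univ_lt_top m a, leafRestrict_univ_lt_top m b,
      leafRestrict_univ_lt_top m p, leafRestrict_univ_lt_top m q,
      Lp.coeFn_sub ((Measure.integrable_toReal_rnDeriv (μ := a.fst) (ν := m)).toL1 _)
        ((Measure.integrable_toReal_rnDeriv (μ := b.fst) (ν := m)).toL1 _),
      (Measure.integrable_toReal_rnDeriv (μ := a.fst) (ν := m)).coeFn_toL1,
      (Measure.integrable_toReal_rnDeriv (μ := b.fst) (ν := m)).coeFn_toL1]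
      with x h1 h2 h3 h4 h5 h6 h7 h8
    have h9 := congrArg (fun ρ : Measure Y => ρ univ) h1
    simp only [Measure.add_apply, leafRestrict_univ] at h9 h2 h3 h4 h5
    have h10 := congrArg ENNReal.toReal h9
    rw [ENNReal.toReal_add h2.ne h5.ne, ENNReal.toReal_add h4.ne h3.ne] at h10
    have h11 : marginalDensity m μ x = (a.fst.rnDeriv m x).toReal - (b.fst.rnDeriv m x).toReal := by
      rw [← h7, ← h8]; exact h6
    rw [h11]
    linarith

lemma jordan_eq (μ : SignedMeasure (X × Y)) :
    μ = μ.toJordanDecomposition.posPart.toSignedMeasure -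
      μ.toJordanDecomposition.negPart.toSignedMeasure :=
  μ.toSignedMeasure_toJordanDecomposition.symm

lemma add_aux [IsFiniteMeasure m] {μ ν : SignedMeasure (X × Y)} (hμ : μ ∈ AB m) (hν : ν ∈ AB m) :
    μ + ν ∈ AB m ∧ lInfNorm m (μ + ν) ≤ lInfNorm m μ + lInfNorm m ν ∧
      marginalDensity m (μ + ν) = marginalDensity m μ + marginalDensity m ν := by
  have h : μ + ν =
      (μ.toJordanDecomposition.posPart + ν.toJordanDecomposition.posPart).toSignedMeasure -
      (μ.toJordanDecomposition.negPart + ν.toJordanDecomposition.negPart).toSignedMeasure := by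
    conv_lhs => rw [jordan_eq μ, jordan_eq ν]
    rw [Measure.toSignedMeasure_add, Measure.toSignedMeasure_add]
    abel
  have hp := Measure.AbsolutelyContinuous.add_left hμ.1 hν.1
  have hq := Measure.AbsolutelyContinuous.add_left hμ.2 hν.2
  rw [← Measure.fst_add] at hp hq
  obtain ⟨h1, h2, h3⟩ := repr_aux m h hp hq
  have hadd := leafRestrict_add m hμ.1 hν.1
  have hadd' := leafRestrict_add m hμ.2 hν.2
  refine ⟨h1, ?_, ?_⟩
  · refine (essSup_mono_ae ?_).trans (ENNReal.essSup_add_le (leafNorm m μ) (leafNorm m ν))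
    filter_upwards [h2, hadd, hadd',
      leafRestrict_univ_lt_top m μ.toJordanDecomposition.posPart,
      leafRestrict_univ_lt_top m μ.toJordanDecomposition.negPart,
      leafRestrict_univ_lt_top m ν.toJordanDecomposition.posPart,
      leafRestrict_univ_lt_top m ν.toJordanDecomposition.negPart] with x h2 ha hb f1 f2 f3 f4
    have := IsFiniteMeasure.mk f1
    have := IsFiniteMeasure.mk f2
    have := IsFiniteMeasure.mk f3
    have := IsFiniteMeasure.mk f4
    rw [h2, ha, hb]
    exact wDist_add_le _ _ _ _
  · refine Lp.ext ?_
    filter_upwards [h3, hadd, hadd', Lp.coeFn_add (marginalDensity m μ) (marginalDensity m ν),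
      (repr_aux m (jordan_eq μ) hμ.1 hμ.2).2.2, (repr_aux m (jordan_eq ν) hν.1 hν.2).2.2,
      leafRestrict_univ_lt_top m μ.toJordanDecomposition.posPart,
      leafRestrict_univ_lt_top m μ.toJordanDecomposition.negPart,
      leafRestrict_univ_lt_top m ν.toJordanDecomposition.posPart,
      leafRestrict_univ_lt_top m ν.toJordanDecomposition.negPart]
      with x h3 ha hb h4 h5 h6 f1 f2 f3 f4
    have ha := congrArg (fun ρ : Measure Y => ρ univ) ha
    have hb := congrArg (fun ρ : Measure Y => ρ univ) hb
    simp only [Measure.add_apply, leafRestrict_univ] at ha hb f1 f2 f3 f4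
    rw [h3, h4, Pi.add_apply, h5, h6, ha, hb, ENNReal.toReal_add f1.ne f3.ne,
      ENNReal.toReal_add f2.ne f4.ne]
    ring

lemma smul_aux [IsFiniteMeasure m] (c : ℝ≥0) {μ : SignedMeasure (X × Y)} (hμ : μ ∈ AB m) :
    (c : ℝ) • μ ∈ AB m ∧ lInfNorm m ((c : ℝ) • μ) = c * lInfNorm m μ ∧
      marginalDensity m ((c : ℝ) • μ) = (c : ℝ) • marginalDensity m μ := by
  have h : (c : ℝ) • μ =
      (c • μ.toJordanDecomposition.posPart).toSignedMeasure -
      (c • μ.toJordanDecomposition.negPart).toSignedMeasure := by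
    conv_lhs => rw [jordan_eq μ]
    rw [Measure.toSignedMeasure_smul, Measure.toSignedMeasure_smul, smul_sub]
    rfl
  have hp : (c • μ.toJordanDecomposition.posPart).fst ≪ m := by
    rw [Measure.fst, Measure.map_smul]; exact hμ.1.smul_left c
  have hq : (c • μ.toJordanDecomposition.negPart).fst ≪ m := by
    rw [Measure.fst, Measure.map_smul]; exact hμ.2.smul_left c
  obtain ⟨h1, h2, h3⟩ := repr_aux m h hp hq
  have hs := leafRestrict_smul m c hμ.1
  have hs' := leafRestrict_smul m c hμ.2
  refine ⟨h1, ?_, ?_⟩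
  · rw [lInfNorm, lInfNorm, ← ENNReal.essSup_const_mul]
    refine essSup_congr_ae ?_
    filter_upwards [h2, hs, hs'] with x h2 ha hb
    rw [h2, ha, hb, wDist_smul]
    rfl
  · refine Lp.ext ?_
    filter_upwards [h3, hs, hs', Lp.coeFn_smul (c : ℝ) (marginalDensity m μ),
      (repr_aux m (jordan_eq μ) hμ.1 hμ.2).2.2] with x h3 ha hb h4 h5
    have e : ∀ ρ : Measure Y, (c • ρ) univ = (c : ℝ≥0∞) * ρ univ := fun ρ => rfl
    have ha := congrArg (fun ρ : Measure Y => ρ univ) ha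
    have hb := congrArg (fun ρ : Measure Y => ρ univ) hb
    simp only [e, leafRestrict_univ] at ha hb
    rw [h3, h4, Pi.smul_apply, h5, ha, hb, ENNReal.toReal_mul, ENNReal.toReal_mul, smul_eq_mul,
      ENNReal.coe_toReal]
    ring

lemma neg_aux {μ : SignedMeasure (X × Y)} (hμ : μ ∈ AB m) :
    -μ ∈ AB m ∧ lInfNorm m (-μ) = lInfNorm m μ ∧
      marginalDensity m (-μ) = -marginalDensity m μ := by
  refine ⟨?_, ?_, ?_⟩
  · refine ⟨?_, ?_⟩
    · simpa [SignedMeasure.toJordanDecomposition_neg] using hμ.2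
    · simpa [SignedMeasure.toJordanDecomposition_neg] using hμ.1
  · have : leafNorm m (-μ) = leafNorm m μ := by
      funext x
      rw [leafNorm, leafNorm, wDist_comm]
      simp only [SignedMeasure.toJordanDecomposition_neg, JordanDecomposition.neg_posPart,
        JordanDecomposition.neg_negPart]
    rw [lInfNorm, lInfNorm, this]
  · rw [marginalDensity, marginalDensity, neg_sub]
    simp only [SignedMeasure.toJordanDecomposition_neg, JordanDecomposition.neg_posPart,
      JordanDecomposition.neg_negPart]

lemma zero_aux [IsFiniteMeasure m] : (0 : SignedMeasure (X × Y)) ∈ AB m := by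
  simp [AB, SignedMeasure.toJordanDecomposition_zero, Measure.AbsolutelyContinuous.zero]

end

variable {m : Measure X} {S : Type*} [NormedAddCommGroup S] [NormedSpace ℝ S]

/-- The space `S^∞` of the signed measures in `AB` with `‖μ‖_∞ < ∞` whose marginal density belongs
to `S`. -/
def SInf (Y : Type*) [MetricSpace Y] [CompactSpace Y] [MeasurableSpace Y] [BorelSpace Y]
    [Nonempty Y] [IsFiniteMeasure m] (ι : S →ₗ[ℝ] (X →₁[m] ℝ)) :
    Submodule ℝ (SignedMeasure (X × Y)) where
  carrier := {μ | μ ∈ AB m ∧ lInfNorm m μ < ⊤ ∧ ∃ f : S, ι f = marginalDensity m μ}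
  add_mem' := by
    rintro μ ν ⟨h1, h2, f, hf⟩ ⟨h3, h4, g, hg⟩
    obtain ⟨k1, k2, k3⟩ := add_aux m h1 h3
    exact ⟨k1, k2.trans_lt (ENNReal.add_lt_top.2 ⟨h2, h4⟩), f + g, by rw [k3, map_add, hf, hg]⟩
  zero_mem' := by
    obtain ⟨-, k2, k3⟩ := smul_aux (Y := Y) m 0 (zero_aux m)
    rw [NNReal.coe_zero, zero_smul] at k2 k3
    exact ⟨zero_aux m, by rw [k2]; simp, 0, by rw [k3, map_zero, zero_smul]⟩
  smul_mem' := by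
    rintro c μ ⟨h1, h2, f, hf⟩
    obtain ⟨k1, k2, k3⟩ := smul_aux m ‖c‖₊ h1
    have k4 : lInfNorm m ((‖c‖₊ : ℝ) • μ) < ⊤ := by
      rw [k2]; exact ENNReal.mul_lt_top ENNReal.coe_lt_top h2
    rcases le_total 0 c with hc | hc
    · have : ((‖c‖₊ : ℝ≥0) : ℝ) = c := by simp [abs_of_nonneg hc]
      rw [this] at k1 k3 k4
      exact ⟨k1, k4, c • f, by rw [k3, map_smul, hf]⟩
    · have : ((‖c‖₊ : ℝ≥0) : ℝ) = -c := by simp [abs_of_nonpos hc]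
      rw [this] at k1 k3 k4
      obtain ⟨n1, n2, n3⟩ := neg_aux m k1
      have e : -((-c) • μ) = c • μ := by ext A hA; simp
      rw [e] at n1 n2 n3
      exact ⟨n1, by rw [n2]; exact k4, c • f, by rw [n3, k3, map_smul, hf, neg_smul, neg_neg]⟩

/-- The norm `‖μ‖_{S^∞} = |φ_x|_s + ‖μ‖_∞`. -/
def sInfNorm {Y : Type*} [MetricSpace Y] [CompactSpace Y] [MeasurableSpace Y] [BorelSpace Y]
    [Nonempty Y] [IsFiniteMeasure m] (ι : S →ₗ[ℝ] (X →₁[m] ℝ)) (μ : SInf Y ι) : ℝ :=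
  ‖μ.2.2.2.choose‖ + (lInfNorm m (μ : SignedMeasure (X × Y))).toReal

/-- The skew product `F(x, y) = (T(x), G(x, y))`. -/
def skewProduct (T : X → X) (G : X × Y → Y) (p : X × Y) : X × Y := (T p.1, G p)

/-- The leaves `{x} × Y` are uniformly contracted. -/
def ContractsLeaves (G : X × Y → Y) : Prop :=
  ∃ α : ℝ, 0 < α ∧ α < 1 ∧ ∀ x y₁ y₂, dist (G (x, y₁)) (G (x, y₂)) ≤ α * dist y₁ y₂

end Measures
end SkewProduct
end

open SkewProduct

/-! Write `F^*` for the push-forward by `F`, `φ` for the marginal density of `μ`, and `f(μ) = μ(Σ)`.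
The functional `f` is invariant under `F^*`, and `|f(μ)| ≤ |φ|₁ ≤ |φ|_s`. So it suffices to find a
fixed vector `μ₀` with `f(μ₀) = 1` and to prove exponential decay on `ker f`. Then `P = f · μ₀` and
`N = F^* - P` do the job, because `N^n = (F^*)^n (1 - P)` for `n ≥ 1`
(`exists_rank_one_decomposition`).

Decay. The marginal density evolves by `P_T`. On the base, convergence to equilibrium gives power
boundedness by Banach–Steinhaus; compactness makes the convergence uniform in `L¹`, and the
Lasota–Yorke inequality carries it to the strong norm, so densities of zero mass decay exponentially
(`exists_spectralGap`). On the leaves, a test function composed with `F^n` is `α^n`-Lipschitz in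
`y`. Up to a constant it is thus `α^n` times a test function, and the constant sees only `φ`. Hence
`‖(F^*)^n μ‖_∞ ≤ M (α^n ‖μ‖_∞ + H |φ|_s)` (`lInfNorm_map_iterate_le`), where `M` bounds all `P_T^n
1` in `L^∞`. Using the base decay for half of the time and the leaf contraction for the other half
gives the rate (`exists_decay_of_totalMass_eq_zero`).

Leafwise estimates are proved after integration over cylinders `A × Y`, whose preimage is `T⁻¹A ×
Y`. No formula for the disintegration of an image is needed.

Fixed vector. The measure `l = ψ_x m` is `T`-invariant. The images of `l × δ_{y₀}` under `F^n` all
have marginal `l`, and their conditional measures on almost every leaf are geometrically Cauchy. The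
weak limits form a kernel `K`, and `l ⊗ K` is invariant (`exists_invariant_measure`). Completeness
of `S^∞` plays no role. -/

namespace SkewProduct

/-! ### Leaf restrictions tested on cylinders -/

section Disintegration

variable {X Y : Type*} [MeasurableSpace X] [MetricSpace Y] [CompactSpace Y] [MeasurableSpace Y]
  [BorelSpace Y] [Nonempty Y] {m : Measure X} [IsFiniteMeasure m]

lemma integral_leafRestrict (p : Measure (X × Y)) [IsFiniteMeasure p] (x : X) (g : Y → ℝ) :
    ∫ y, g y ∂(leafRestrict m p x) =
      (p.fst.rnDeriv m x).toReal • ∫ y, g y ∂(p.condKernel x) := by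
  rw [leafRestrict, integral_smul_measure]

lemma integrable_integral_leafRestrict {p : Measure (X × Y)} [IsFiniteMeasure p]
    (hp : p.fst ≪ m) {h : X × Y → ℝ} (hh : Integrable h p) :
    Integrable (fun x => ∫ y, h (x, y) ∂(leafRestrict m p x)) m := by
  simp only [integral_leafRestrict]
  exact (integrable_rnDeriv_smul_iff hp).2 hh.integral_condKernel

/-- The bridge between leafwise quantities and integrals over cylinders; leaf restrictions of image
measures are accessed only through it. -/
lemma setIntegral_prod_univ {p : Measure (X × Y)} [IsFiniteMeasure p]
    (hp : p.fst ≪ m) {h : X × Y → ℝ} (hh : Integrable h p) {A : Set X} (hA : MeasurableSet A) :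
    ∫ z in A ×ˢ univ, h z ∂p = ∫ x in A, ∫ y, h (x, y) ∂(leafRestrict m p x) ∂m := by
  simp only [integral_leafRestrict]
  rw [setIntegral_rnDeriv_smul hp hA, Measure.setIntegral_condKernel_univ_right hA hh.integrableOn]

/-- Duality estimate for a function whose oscillation is controlled by a Lipschitz constant. -/
lemma abs_integral_sub_le_of_wDist_le {μ ν : Measure Y} [IsFiniteMeasure μ] [IsFiniteMeasure ν]
    (hdiam : ∀ y₁ y₂ : Y, dist y₁ y₂ ≤ 1) {α b c : ℝ} (hα : 0 < α) (hc : 0 ≤ c)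
    (hw : wDist μ ν ≤ ENNReal.ofReal c) (hb : |μ.real univ - ν.real univ| ≤ b)
    {g : Y → ℝ} (hg : ∀ y₁ y₂, |g y₁ - g y₂| ≤ α * dist y₁ y₂) (hg1 : ∀ y, |g y| ≤ 1) :
    |∫ y, g y ∂μ - ∫ y, g y ∂ν| ≤ α * c + b := by
  obtain ⟨y₀⟩ := ‹Nonempty Y›
  -- As distances are at most 1, subtracting `g y₀` and dividing by `α` gives a function that is
  -- both 1-Lipschitz and bounded by 1. The subtracted constant only sees the difference of the
  -- masses.
  set k : Y → ℝ := fun y => (g y - g y₀) / α with hk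
  have hkL : LipschitzWith 1 k := by
    refine LipschitzWith.of_dist_le_mul fun y₁ y₂ => ?_
    rw [Real.dist_eq, hk]
    simp only [NNReal.coe_one, one_mul]
    rw [← sub_div, sub_sub_sub_cancel_right, abs_div, abs_of_pos hα, div_le_iff₀ hα, mul_comm]
    exact hg y₁ y₂
  have hkb : ∀ y, |k y| ≤ 1 := fun y => by
    rw [hk]
    simp only
    rw [abs_div, abs_of_pos hα, div_le_iff₀ hα, one_mul]
    exact (hg y y₀).trans (mul_le_of_le_one_right hα.le (hdiam y y₀))
  have h1 : |∫ y, k y ∂μ - ∫ y, k y ∂ν| ≤ c := by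
    have := (le_iSup_of_le (⟨k, hkL, hkb⟩ : {g : Y → ℝ // LipschitzWith 1 g ∧ ∀ y, |g y| ≤ 1})
      le_rfl).trans hw
    exact (ENNReal.ofReal_le_ofReal_iff hc).1 this
  have hgk : ∀ y, g y = α * k y + g y₀ := fun y => by
    rw [hk]; field_simp; ring
  have hi : ∀ ρ : Measure Y, IsFiniteMeasure ρ →
      ∫ y, g y ∂ρ = α * ∫ y, k y ∂ρ + ρ.real univ * g y₀ := by
    intro ρ hρ
    rw [integral_congr_ae (.of_forall hgk),
      integral_add ((integrable_of_bound ρ ⟨k, hkL, hkb⟩).const_mul α) (integrable_const _),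
      integral_const_mul, integral_const, smul_eq_mul]
  rw [hi μ inferInstance, hi ν inferInstance]
  have e : α * ∫ y, k y ∂μ + μ.real univ * g y₀ - (α * ∫ y, k y ∂ν + ν.real univ * g y₀) =
      α * (∫ y, k y ∂μ - ∫ y, k y ∂ν) + (μ.real univ - ν.real univ) * g y₀ := by ring
  rw [e]
  refine (abs_add_le _ _).trans (add_le_add ?_ ?_)
  · rw [abs_mul, abs_of_pos hα]
    exact mul_le_mul_of_nonneg_left h1 hα.le
  · rw [abs_mul]
    exact (mul_le_of_le_one_right (abs_nonneg _) (hg1 y₀)).trans hb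

lemma isFiniteMeasure_leafRestrict_ae (p : Measure (X × Y)) [IsFiniteMeasure p] :
    ∀ᵐ x ∂m, IsFiniteMeasure (leafRestrict m p x) := by
  filter_upwards [leafRestrict_univ_lt_top m p] with x hx using ⟨hx⟩

lemma leafRestrict_real_univ (p : Measure (X × Y)) [IsFiniteMeasure p] (x : X) :
    (leafRestrict m p x).real univ = (p.fst.rnDeriv m x).toReal := by
  rw [Measure.real, leafRestrict_univ]

/-- The duality estimate on each leaf, integrated over `A`. Linearity of the bound in the measure of
`A` is what allows a return to almost every leaf. -/
lemma abs_setIntegral_sub_le {p q : Measure (X × Y)} [IsFiniteMeasure p] [IsFiniteMeasure q]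
    (hp : p.fst ≪ m) (hq : q.fst ≪ m)
    (hdiam : ∀ y₁ y₂ : Y, dist y₁ y₂ ≤ 1) {α b c : ℝ} (hα : 0 < α) (hc : 0 ≤ c)
    (hw : ∀ᵐ x ∂m, wDist (leafRestrict m p x) (leafRestrict m q x) ≤ ENNReal.ofReal c)
    (hb : ∀ᵐ x ∂m, |(p.fst.rnDeriv m x).toReal - (q.fst.rnDeriv m x).toReal| ≤ b)
    {h : X × Y → ℝ} (hm : Measurable h)
    (hL : ∀ x y₁ y₂, |h (x, y₁) - h (x, y₂)| ≤ α * dist y₁ y₂) (h1 : ∀ z, |h z| ≤ 1)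
    {A : Set X} (hA : MeasurableSet A) :
    |∫ z in A ×ˢ univ, h z ∂p - ∫ z in A ×ˢ univ, h z ∂q| ≤ (α * c + b) * m.real A := by
  have hip : Integrable h p := Integrable.of_bound hm.aestronglyMeasurable 1 (.of_forall h1)
  have hiq : Integrable h q := Integrable.of_bound hm.aestronglyMeasurable 1 (.of_forall h1)
  rw [setIntegral_prod_univ hp hip hA, setIntegral_prod_univ hq hiq hA,
    ← integral_sub (integrable_integral_leafRestrict hp hip).integrableOn
      (integrable_integral_leafRestrict hq hiq).integrableOn, ← Real.norm_eq_abs]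
  refine norm_setIntegral_le_of_norm_le_const_ae (measure_lt_top m A) (ae_restrict_of_ae ?_)
  filter_upwards [hw, hb, isFiniteMeasure_leafRestrict_ae p, isFiniteMeasure_leafRestrict_ae q]
    with x hx hbx _ _
  rw [Real.norm_eq_abs]
  refine abs_integral_sub_le_of_wDist_le hdiam hα hc hx ?_ (hL x) fun y => h1 _
  rwa [leafRestrict_real_univ, leafRestrict_real_univ]

lemma ae_abs_le_of_forall_abs_setIntegral_le {f : X → ℝ} (hf : Integrable f m) {c : ℝ}
    (h : ∀ A, MeasurableSet A → |∫ x in A, f x ∂m| ≤ c * m.real A) : ∀ᵐ x ∂m, |f x| ≤ c := by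
  have h1 : f ≤ᵐ[m] fun _ => c :=
    ae_le_of_forall_setIntegral_le hf (integrable_const c) fun A hA _ => by
      rw [setIntegral_const, smul_eq_mul, mul_comm]
      exact (le_abs_self _).trans (h A hA)
  have h2 : (fun x => - f x) ≤ᵐ[m] fun _ => c :=
    ae_le_of_forall_setIntegral_le hf.neg (integrable_const c) fun A hA _ => by
      rw [setIntegral_const, smul_eq_mul, mul_comm, integral_neg]
      exact (neg_le_abs _).trans (h A hA)
  filter_upwards [h1, h2] with x hx hx'
  exact abs_le'.2 ⟨hx, hx'⟩

/-- The test functions that define `wDist`. -/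
def testFunctions (Y : Type*) [MetricSpace Y] : Set C(Y, ℝ) :=
  {g | LipschitzWith 1 g ∧ ∀ y, |g y| ≤ 1}

/-- `C(Y, ℝ)` is separable. A countable family is needed because the exceptional null set of a
leafwise bound depends on the test function. -/
lemma exists_countable_dense_testFunctions (Y : Type*) [MetricSpace Y] [CompactSpace Y] :
    ∃ D : Set C(Y, ℝ), D ⊆ testFunctions Y ∧ D.Countable ∧ testFunctions Y ⊆ closure D :=
  (TopologicalSpace.IsSeparable.of_separableSpace (testFunctions Y)).exists_countable_dense_subset

lemma abs_integral_sub_integral_le {ρ : Measure Y} [IsFiniteMeasure ρ] (f g : C(Y, ℝ)) :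
    |∫ y, f y ∂ρ - ∫ y, g y ∂ρ| ≤ dist f g * ρ.real univ := by
  have hi : ∀ f : C(Y, ℝ), Integrable f ρ := fun f =>
    Integrable.of_bound f.continuous.measurable.aestronglyMeasurable ‖f‖
      (.of_forall f.norm_coe_le_norm)
  rw [← integral_sub (hi f) (hi g), ← Real.norm_eq_abs]
  refine norm_integral_le_of_norm_le_const (.of_forall fun y => ?_)
  rw [Real.norm_eq_abs, ← Real.dist_eq]
  exact ContinuousMap.dist_apply_le_dist y

lemma continuous_integral_continuousMap (ρ : Measure Y) [IsFiniteMeasure ρ] :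
    Continuous fun f : C(Y, ℝ) => ∫ y, f y ∂ρ :=
  (LipschitzWith.of_dist_le_mul (K := (ρ univ).toNNReal) fun f g => by
    rw [Real.dist_eq, mul_comm]; exact abs_integral_sub_integral_le f g).continuous

/-- An almost everywhere bound for each test function separately gives an almost everywhere bound
for `wDist`. -/
lemma ae_wDist_le {κ η : X → Measure Y} {c : ℝ} (hκ : ∀ᵐ x ∂m, IsFiniteMeasure (κ x))
    (hη : ∀ᵐ x ∂m, IsFiniteMeasure (η x))
    (h : ∀ g ∈ testFunctions Y, ∀ᵐ x ∂m, |∫ y, g y ∂(κ x) - ∫ y, g y ∂(η x)| ≤ c) :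
    ∀ᵐ x ∂m, wDist (κ x) (η x) ≤ ENNReal.ofReal c := by
  obtain ⟨D, hDs, hDc, hDd⟩ := exists_countable_dense_testFunctions Y
  filter_upwards [hκ, hη, (ae_ball_iff hDc).2 fun g hg => h g (hDs hg)] with x _ _ hx
  refine iSup_le fun g => ENNReal.ofReal_le_ofReal ?_
  -- The bound holds on `D` and is a closed condition for uniform convergence, so it passes to all
  -- test functions.
  have hcl : IsClosed {f : C(Y, ℝ) | |∫ y, f y ∂(κ x) - ∫ y, f y ∂(η x)| ≤ c} :=
    isClosed_le ((continuous_integral_continuousMap _).sub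
      (continuous_integral_continuousMap _)).abs continuous_const
  exact closure_minimal hx hcl
    (hDd (show (⟨g.1, g.2.1.continuous⟩ : C(Y, ℝ)) ∈ testFunctions Y from g.2))

/-- For fixed `g`, a bound linear in `m A` on all cylinders gives a bound on almost every leaf;
`ae_wDist_le` then makes the null set independent of `g`. -/
lemma ae_wDist_leafRestrict_le {p q : Measure (X × Y)} [IsFiniteMeasure p] [IsFiniteMeasure q]
    (hp : p.fst ≪ m) (hq : q.fst ≪ m) {c : ℝ}
    (h : ∀ g ∈ testFunctions Y, ∀ A, MeasurableSet A →
      |∫ z in A ×ˢ univ, g z.2 ∂p - ∫ z in A ×ˢ univ, g z.2 ∂q| ≤ c * m.real A) :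
    ∀ᵐ x ∂m, wDist (leafRestrict m p x) (leafRestrict m q x) ≤ ENNReal.ofReal c := by
  refine ae_wDist_le (isFiniteMeasure_leafRestrict_ae p) (isFiniteMeasure_leafRestrict_ae q)
    fun g hg => ?_
  have hi : ∀ ρ : Measure (X × Y), IsFiniteMeasure ρ → Integrable (fun z : X × Y => g z.2) ρ :=
    fun ρ _ => Integrable.of_bound
      (g.continuous.measurable.comp measurable_snd).aestronglyMeasurable 1
      (.of_forall fun z => hg.2 z.2)
  have ip := integrable_integral_leafRestrict hp (hi p inferInstance)
  have iq := integrable_integral_leafRestrict hq (hi q inferInstance)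
  refine ae_abs_le_of_forall_abs_setIntegral_le (ip.sub iq) fun A hA => ?_
  have := h g hg A hA
  rw [setIntegral_prod_univ hp (hi p inferInstance) hA,
    setIntegral_prod_univ hq (hi q inferInstance) hA,
    ← integral_sub ip.integrableOn iq.integrableOn] at this
  exact this

end Disintegration

/-! ### Images under skew products and their iterates -/

section SignedMeasures

variable {X Y : Type*} [MeasurableSpace X] [MeasurableSpace Y]

lemma measurable_skewProduct {T : X → X} {G : X × Y → Y} (hT : Measurable T)
    (hG : Measurable G) : Measurable (skewProduct T G) :=
  (hT.comp measurable_fst).prodMk hG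

lemma fst_map_skewProduct {T : X → X} {G : X × Y → Y} (hT : Measurable T) (hG : Measurable G)
    (p : Measure (X × Y)) : (p.map (skewProduct T G)).fst = p.fst.map T := by
  rw [Measure.fst, Measure.fst, Measure.map_map measurable_fst (measurable_skewProduct hT hG),
    Measure.map_map hT measurable_fst]
  rfl

/-- The images of the two Jordan parts need not be mutually singular, so this is in general not the
Jordan decomposition of the image; `repr_aux` accepts it all the same. -/
lemma map_toSignedMeasure_sub {Z W : Type*} [MeasurableSpace Z] [MeasurableSpace W] {F : Z → W}
    (hF : Measurable F) (p q : Measure Z) [IsFiniteMeasure p] [IsFiniteMeasure q] :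
    (p.toSignedMeasure - q.toSignedMeasure).map F =
      (p.map F).toSignedMeasure - (q.map F).toSignedMeasure := by
  ext A hA
  rw [VectorMeasure.map_apply _ hF hA, Measure.toSignedMeasure_sub_apply hA,
    Measure.toSignedMeasure_sub_apply (hF hA), map_measureReal_apply hF hA,
    map_measureReal_apply hF hA]

/-- The iterates of a skew product are skew products. -/
lemma iterate_skewProduct (T : X → X) (G : X × Y → Y) (n : ℕ) :
    (skewProduct T G)^[n] = skewProduct T^[n] (fun z => ((skewProduct T G)^[n] z).2) := by
  have h : ∀ z, ((skewProduct T G)^[n] z).1 = T^[n] z.1 := by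
    intro z
    induction n with
    | zero => rfl
    | succ n ih =>
      rw [Function.iterate_succ_apply', Function.iterate_succ_apply', ← ih]
      rfl
  funext z
  exact Prod.ext (h z) rfl

/-- After one step, two points of the leaf over `x` lie on the common leaf over `T x`, so the
contraction factors multiply. -/
lemma dist_iterate_skewProduct_le {Y : Type*} [MetricSpace Y] (T : X → X) {G : X × Y → Y} {α : ℝ}
    (hα : 0 < α) (hG : ∀ x y₁ y₂, dist (G (x, y₁)) (G (x, y₂)) ≤ α * dist y₁ y₂) (n : ℕ)
    (x : X) (y₁ y₂ : Y) :
    dist ((skewProduct T G)^[n] (x, y₁)).2 ((skewProduct T G)^[n] (x, y₂)).2 ≤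
      α ^ n * dist y₁ y₂ := by
  induction n generalizing x y₁ y₂ with
  | zero => simp
  | succ n ih =>
    rw [Function.iterate_succ_apply, Function.iterate_succ_apply]
    refine (ih _ _ _).trans ?_
    rw [pow_succ, mul_assoc]
    exact mul_le_mul_of_nonneg_left (hG x y₁ y₂) (by positivity)

lemma map_map_signedMeasure {Z : Type*} [MeasurableSpace Z] {F F' : Z → Z} (hF : Measurable F)
    (hF' : Measurable F') (μ : SignedMeasure Z) :
    VectorMeasure.map (VectorMeasure.map μ F) F' = VectorMeasure.map μ (F' ∘ F) := by
  ext A hA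
  rw [VectorMeasure.map_apply _ hF' hA, VectorMeasure.map_apply _ hF (hF' hA),
    VectorMeasure.map_apply _ (hF'.comp hF) hA]
  rfl

end SignedMeasures

/-! ### One step of the transfer operator -/

section Transfer

variable {X Y : Type*} [MeasurableSpace X] [MetricSpace Y] [CompactSpace Y] [MeasurableSpace Y]
  [BorelSpace Y] [Nonempty Y] {m : Measure X} [IsFiniteMeasure m]

/-- Describes the marginal density by `μ` itself, linearly and without the Jordan decomposition, so
that identities between densities follow by comparing set integrals. -/
lemma setIntegral_marginalDensity {μ : SignedMeasure (X × Y)} (hμ : μ ∈ AB m) {A : Set X}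
    (hA : MeasurableSet A) : ∫ x in A, marginalDensity m μ x ∂m = μ (A ×ˢ univ) := by
  rw [setIntegral_congr_ae hA ((repr_aux m (jordan_eq μ) hμ.1 hμ.2).2.2.mono fun x hx _ => hx),
    integral_sub Measure.integrable_toReal_rnDeriv.integrableOn
      Measure.integrable_toReal_rnDeriv.integrableOn,
    Measure.setIntegral_toReal_rnDeriv hμ.1, Measure.setIntegral_toReal_rnDeriv hμ.2]
  conv_rhs => rw [jordan_eq μ]
  rw [Measure.toSignedMeasure_sub_apply (hA.prod MeasurableSet.univ), Measure.real, Measure.real,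
    Measure.fst_apply hA, Measure.fst_apply hA, prod_univ]
  rfl

lemma fst_map_absolutelyContinuous {T : X → X} {G : X × Y → Y}
    (hT : Measure.QuasiMeasurePreserving T m m) (hG : Measurable G) {p : Measure (X × Y)}
    (hp : p.fst ≪ m) : (p.map (skewProduct T G)).fst ≪ m := by
  rw [fst_map_skewProduct hT.measurable hG]
  exact (hp.map hT.measurable).trans hT.absolutelyContinuous

/-- The preimage of a cylinder is the cylinder over `T⁻¹A`, so the several preimages of a base point
never have to be separated. -/
lemma setIntegral_map_skewProduct {T : X → X} {G : X × Y → Y} (hT : Measurable T)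
    (hG : Measurable G) (p : Measure (X × Y)) {h : X × Y → ℝ} (hh : Measurable h) {A : Set X}
    (hA : MeasurableSet A) :
    ∫ z in A ×ˢ univ, h z ∂(p.map (skewProduct T G)) =
      ∫ z in (T ⁻¹' A) ×ˢ univ, h (skewProduct T G z) ∂p := by
  rw [setIntegral_map (hA.prod MeasurableSet.univ) hh.aestronglyMeasurable
    (measurable_skewProduct hT hG).aemeasurable]
  congr 2

lemma map_mem_AB {T : X → X} {G : X × Y → Y}
    (hT : Measure.QuasiMeasurePreserving T m m) (hG : Measurable G) {μ : SignedMeasure (X × Y)}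
    (hμ : μ ∈ AB m) : VectorMeasure.map μ (skewProduct T G) ∈ AB m := by
  have hF := measurable_skewProduct hT.measurable hG
  have hrep := map_toSignedMeasure_sub hF μ.toJordanDecomposition.posPart
    μ.toJordanDecomposition.negPart
  rw [← jordan_eq] at hrep
  exact (repr_aux m hrep (fst_map_absolutelyContinuous hT hG hμ.1)
    (fst_map_absolutelyContinuous hT hG hμ.2)).1

/-- A skew product contracts the leafwise norm, up to the size of the marginal density. -/
lemma lInfNorm_map_le {T : X → X} {G : X × Y → Y}
    (hT : Measure.QuasiMeasurePreserving T m m) (hG : Measurable G)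
    (hdiam : ∀ y₁ y₂ : Y, dist y₁ y₂ ≤ 1) {α b c M : ℝ} (hα : 0 < α)
    (hcontr : ∀ x y₁ y₂, dist (G (x, y₁)) (G (x, y₂)) ≤ α * dist y₁ y₂)
    (hM : ∀ A, MeasurableSet A → m.real (T ⁻¹' A) ≤ M * m.real A)
    {μ : SignedMeasure (X × Y)} (hμ : μ ∈ AB m) (hc : 0 ≤ c) (hb0 : 0 ≤ b)
    (hw : lInfNorm m μ ≤ ENNReal.ofReal c) (hb : ∀ᵐ x ∂m, |marginalDensity m μ x| ≤ b) :
    lInfNorm m (VectorMeasure.map μ (skewProduct T G)) ≤ ENNReal.ofReal ((α * c + b) * M) := by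
  have hF := measurable_skewProduct hT.measurable hG
  set p := μ.toJordanDecomposition.posPart
  set q := μ.toJordanDecomposition.negPart
  have hrep : VectorMeasure.map μ (skewProduct T G) = (p.map (skewProduct T G)).toSignedMeasure -
      (q.map (skewProduct T G)).toSignedMeasure := by
    rw [← map_toSignedMeasure_sub hF, ← jordan_eq]
  have hp := fst_map_absolutelyContinuous hT hG hμ.1
  have hq := fst_map_absolutelyContinuous hT hG hμ.2
  obtain ⟨-, h2, -⟩ := repr_aux m hrep hp hq
  obtain ⟨-, -, h3⟩ := repr_aux m (jordan_eq μ) hμ.1 hμ.2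
  have hw' : ∀ᵐ x ∂m, wDist (leafRestrict m p x) (leafRestrict m q x) ≤ ENNReal.ofReal c := by
    filter_upwards [ENNReal.ae_le_essSup (leafNorm m μ)] with x hx
    exact hx.trans hw
  have hb' : ∀ᵐ x ∂m, |(p.fst.rnDeriv m x).toReal - (q.fst.rnDeriv m x).toReal| ≤ b := by
    filter_upwards [h3, hb] with x hx hx'
    rwa [← hx]
  refine essSup_le_of_ae_le _ ?_
  have key : ∀ᵐ x ∂m, wDist (leafRestrict m (p.map (skewProduct T G)) x)
      (leafRestrict m (q.map (skewProduct T G)) x) ≤ ENNReal.ofReal ((α * c + b) * M) := by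
    -- Since `g` is 1-Lipschitz, its composition with `F` is `α`-Lipschitz on leaves. The estimate
    -- over `T⁻¹A` gives `(α c + b) m(T⁻¹A)`, and `hM` returns to `A`.
    refine ae_wDist_leafRestrict_le hp hq fun g hg A hA => ?_
    have hgm : Measurable fun z : X × Y => g z.2 := g.continuous.measurable.comp measurable_snd
    rw [setIntegral_map_skewProduct hT.measurable hG p hgm hA,
      setIntegral_map_skewProduct hT.measurable hG q hgm hA]
    refine (abs_setIntegral_sub_le hμ.1 hμ.2 hdiam hα hc hw' hb' (hgm.comp hF) ?_
      (fun z => hg.2 _) (hT.measurable hA)).trans ?_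
    · intro x y₁ y₂
      refine le_trans ?_ (hcontr x y₁ y₂)
      have := hg.1.dist_le_mul (G (x, y₁)) (G (x, y₂))
      rwa [Real.dist_eq, NNReal.coe_one, one_mul] at this
    · rw [mul_assoc]
      exact mul_le_mul_of_nonneg_left (hM A hA) (by positivity)
  filter_upwards [h2, key] with x hx hx'
  rwa [hx]

lemma setIntegral_perronFrobenius {T : X → X} (hT : Measure.QuasiMeasurePreserving T m m)
    (φ : X →₁[m] ℝ) {A : Set X} (hA : MeasurableSet A) :
    ∫ x in A, perronFrobenius m T φ x ∂m = ∫ x in T ⁻¹' A, φ x ∂m := by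
  have h := integral_mul_perronFrobenius m hT φ (ψ := A.indicator fun _ => 1)
    (measurable_const.indicator hA) (c := 1) fun x => by
      by_cases hx : x ∈ A <;> simp [hx]
  rw [← integral_indicator hA, ← integral_indicator (hT.measurable hA)]
  refine (integral_congr_ae (.of_forall fun x => ?_)).trans
    (h.trans (integral_congr_ae (.of_forall fun x => ?_)))
  · by_cases hx : x ∈ A <;> simp [hx]
  · by_cases hx : T x ∈ A <;> simp [hx]

/-- The positive and negative parts are pushed forward separately, each keeping its mass;
cancellation between the images only lowers the norm. -/
lemma norm_perronFrobenius_le {T : X → X} (hT : Measure.QuasiMeasurePreserving T m m)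
    (φ : X →₁[m] ℝ) : ‖perronFrobenius m T φ‖ ≤ ‖φ‖ := by
  have hφ := L1.integrable_coeFn φ
  have hn : ∀ {f : X → ℝ} (hf : Integrable f m),
      ‖(integrable_pushDensity m T hf).toL1 _‖ = ∫ x, max (f x) 0 ∂m := by
    intro f hf
    have h := integral_mul_pushDensity m hT hf (ψ := fun _ => 1) measurable_const
    simp only [one_mul] at h
    rw [L1.norm_eq_integral_norm, ← h]
    refine integral_congr_ae ?_
    filter_upwards [(integrable_pushDensity m T hf).coeFn_toL1] with x hx
    rw [hx, Real.norm_eq_abs]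
    exact abs_of_nonneg ENNReal.toReal_nonneg
  refine (norm_sub_le _ _).trans ?_
  rw [hn hφ, hn hφ.neg, ← integral_add hφ.pos_part hφ.neg.pos_part, L1.norm_eq_integral_norm]
  refine (integral_congr_ae (.of_forall fun x => ?_)).le
  simp only [Pi.neg_apply, Real.norm_eq_abs]
  rcases le_total 0 (φ x) with h | h
  · rw [max_eq_left h, max_eq_right (by linarith), abs_of_nonneg h, add_zero]
  · rw [max_eq_right h, max_eq_left (by linarith), abs_of_nonpos h, zero_add]

lemma L1_ext_of_setIntegral_eq {f g : X →₁[m] ℝ}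
    (h : ∀ A, MeasurableSet A → ∫ x in A, f x ∂m = ∫ x in A, g x ∂m) : f = g :=
  Lp.ext (Integrable.ae_eq_of_forall_setIntegral_eq _ _ (L1.integrable_coeFn f)
    (L1.integrable_coeFn g) fun A hA _ => h A hA)

/-- Over every `A`, both sides integrate to `μ(T⁻¹A × Y)`. -/
lemma marginalDensity_map {T : X → X} {G : X × Y → Y}
    (hT : Measure.QuasiMeasurePreserving T m m) (hG : Measurable G) {μ : SignedMeasure (X × Y)}
    (hμ : μ ∈ AB m) :
    marginalDensity m (VectorMeasure.map μ (skewProduct T G)) =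
      perronFrobenius m T (marginalDensity m μ) := by
  refine L1_ext_of_setIntegral_eq fun A hA => ?_
  rw [setIntegral_marginalDensity (map_mem_AB hT hG hμ) hA, setIntegral_perronFrobenius hT _ hA,
    setIntegral_marginalDensity hμ (hT.measurable hA),
    VectorMeasure.map_apply _ (measurable_skewProduct hT.measurable hG)
      (hA.prod MeasurableSet.univ)]
  congr 1

end Transfer

/-! ### Exponential decay from Lasota–Yorke and compactness -/

section SpectralGap

variable {S E : Type*} [NormedAddCommGroup S] [NormedSpace ℝ S] [NormedAddCommGroup E]
  [NormedSpace ℝ E]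

/-- A contraction of the weak norm that tends to zero pointwise does so uniformly on relatively
compact sets. -/
lemma eventually_norm_pow_lt {ι : S →ₗ[ℝ] E} {A : S →L[ℝ] S}
    (hA : ∀ f, ‖ι (A f)‖ ≤ ‖ι f‖) {K : Set S} (hK : TotallyBounded (ι '' K))
    (hlim : ∀ f ∈ K, Tendsto (fun n : ℕ => ι ((A ^ n) f)) atTop (𝓝 0)) {ε : ℝ} (hε : 0 < ε) :
    ∀ᶠ n : ℕ in atTop, ∀ f ∈ K, ‖ι ((A ^ n) f)‖ < ε := by
  -- The centres of the net lie in `ι '' K`, so `hlim` applies to them. Since `A` does not expand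
  -- the weak norm, the distance to the nearest centre stays below `ε / 2` under all iterates.
  obtain ⟨t, ht, htf, hcov⟩ := Metric.finite_approx_of_totallyBounded hK (ε / 2) (by positivity)
  have hpow : ∀ (n : ℕ) f, ‖ι ((A ^ n) f)‖ ≤ ‖ι f‖ := by
    intro n f
    induction n with
    | zero => simp
    | succ n ih => rw [pow_succ']; exact (hA _).trans ih
  have hev : ∀ᶠ n : ℕ in atTop, ∀ y ∈ t, ∃ g, ι g = y ∧ ‖ι ((A ^ n) g)‖ < ε / 2 := by
    refine (htf.eventually_all).2 fun y hy => ?_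
    obtain ⟨g, hg, rfl⟩ := ht hy
    have := (hlim g hg).norm
    rw [norm_zero] at this
    filter_upwards [this.eventually_lt_const (half_pos hε)] with n hn using ⟨g, rfl, hn⟩
  filter_upwards [hev] with n hn f hf
  obtain ⟨y, hy, hfy⟩ := mem_iUnion₂.1 (hcov (mem_image_of_mem _ hf))
  obtain ⟨g, rfl, hg⟩ := hn y hy
  rw [Metric.mem_ball, dist_eq_norm, ← map_sub] at hfy
  calc ‖ι ((A ^ n) f)‖ = ‖ι ((A ^ n) (f - g)) + ι ((A ^ n) g)‖ := by
        rw [← map_add, ← map_add, sub_add_cancel]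
    _ ≤ ‖ι ((A ^ n) (f - g))‖ + ‖ι ((A ^ n) g)‖ := norm_add_le _ _
    _ < ε / 2 + ε / 2 := add_lt_add_of_le_of_lt ((hpow n _).trans hfy.le) hg
    _ = ε := add_halves ε

/-- The weak norm does not grow along the orbit, so the weak terms are dominated by the geometric
series `C + β C + β² C + ⋯`. -/
lemma norm_pow_mul_le_of_lasotaYorke {ι : S →ₗ[ℝ] E} {A : S →L[ℝ] S}
    (hA : ∀ f, ‖ι (A f)‖ ≤ ‖ι f‖) {k : ℕ} {β C : ℝ} (hβ : 0 < β) (hβ1 : β < 1) (hC : 0 < C)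
    (hLY : ∀ f, ‖(A ^ k) f‖ ≤ β * ‖f‖ + C * ‖ι f‖) (j : ℕ) (f : S) :
    ‖(A ^ (k * j)) f‖ ≤ β ^ j * ‖f‖ + C / (1 - β) * ‖ι f‖ := by
  have hpow : ∀ (n : ℕ) f, ‖ι ((A ^ n) f)‖ ≤ ‖ι f‖ := by
    intro n f
    induction n with
    | zero => simp
    | succ n ih => rw [pow_succ']; exact (hA _).trans ih
  have h1 : 0 < 1 - β := by linarith
  induction j with
  | zero => simp; positivity
  | succ j ih =>
    have e : (A ^ (k * (j + 1))) f = (A ^ k) ((A ^ (k * j)) f) := by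
      rw [mul_add, mul_one, add_comm, pow_add]; rfl
    rw [e]
    calc ‖(A ^ k) ((A ^ (k * j)) f)‖ ≤ β * ‖(A ^ (k * j)) f‖ + C * ‖ι ((A ^ (k * j)) f)‖ := hLY _
      _ ≤ β * (β ^ j * ‖f‖ + C / (1 - β) * ‖ι f‖) + C * ‖ι f‖ := by
        gcongr; exact hpow _ _
      _ = β ^ (j + 1) * ‖f‖ + C / (1 - β) * ‖ι f‖ := by
        field_simp; ring

/-- The Lasota-Yorke inequality and compactness turn pointwise convergence to zero on an
invariant subspace into exponential convergence. -/
lemma exists_exponential_decay [CompleteSpace S] {ι : S →ₗ[ℝ] E} {A : S →L[ℝ] S}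
    (hι : ∀ f, ‖ι f‖ ≤ ‖f‖) (hA : ∀ f, ‖ι (A f)‖ ≤ ‖ι f‖)
    (hK : IsCompact (closure (ι '' Metric.closedBall 0 1)))
    (hLY : ∃ (k : ℕ) (β C : ℝ), 0 < β ∧ β < 1 ∧ 0 < C ∧
      ∀ f, ‖(A ^ k) f‖ ≤ β * ‖f‖ + C * ‖ι f‖)
    {B : ℝ} (hB : ∀ (n : ℕ) f, ‖(A ^ n) f‖ ≤ B * ‖f‖)
    (V : Submodule ℝ S) (hV : ∀ f ∈ V, A f ∈ V)
    (hlim : ∀ f ∈ V, Tendsto (fun n : ℕ => (A ^ n) f) atTop (𝓝 0)) :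
    ∃ D r : ℝ, 0 < D ∧ 0 < r ∧ r < 1 ∧ ∀ f ∈ V, ∀ n : ℕ, ‖(A ^ n) f‖ ≤ D * r ^ n * ‖f‖ := by
  obtain ⟨k, β, C, hβ, hβ1, hC, hLY⟩ := hLY
  have h1 : 0 < 1 - β := by linarith
  have hVn : ∀ (n : ℕ), ∀ f ∈ V, (A ^ n) f ∈ V := by
    intro n f hf
    induction n with
    | zero => simpa
    | succ n ih => rw [pow_succ']; exact hV _ ih
  -- A positive bound is needed, because `j` is chosen below by dividing by it.
  set B' := max B 1 with hB'
  have hB1 : 1 ≤ B' := le_max_right _ _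
  have hBn : ∀ (n : ℕ) f, ‖(A ^ n) f‖ ≤ B' * ‖f‖ := fun n f =>
    (hB n f).trans (mul_le_mul_of_nonneg_right (le_max_left _ _) (norm_nonneg _))
  set C' := C / (1 - β) with hC'
  have hC'0 : 0 < C' := by positivity
  have hTB : TotallyBounded (ι '' (Metric.closedBall 0 1 ∩ (V : Set S))) :=
    hK.totallyBounded.subset ((image_mono inter_subset_left).trans subset_closure)
  -- The time `l` makes the weak term at most a quarter of `‖f‖`, and `j` does the same for the
  -- strong term. Thus `k * j + l` steps halve the norm on `V`. Taking `l ≥ 1` keeps this number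
  -- positive.
  have hunif := eventually_norm_pow_lt hA hTB (fun f hf => by
    refine squeeze_zero_norm (fun n => hι _) ?_
    simpa using (hlim f hf.2).norm) (ε := 1 / (4 * C')) (by positivity)
  obtain ⟨l, hl, hl1⟩ := (hunif.and (eventually_ge_atTop 1)).exists
  obtain ⟨j, hj⟩ := exists_pow_lt_of_lt_one (show 0 < 1 / (4 * B') by positivity) hβ1
  have hweak : ∀ f ∈ V, ‖ι ((A ^ l) f)‖ ≤ 1 / (4 * C') * ‖f‖ := by
    intro f hf
    rcases eq_or_ne f 0 with rfl | hf0
    · simp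
    have hn : 0 < ‖f‖ := norm_pos_iff.2 hf0
    have := (hl (‖f‖⁻¹ • f) ⟨by simp [norm_smul, hn.ne'], V.smul_mem _ hf⟩).le
    rw [map_smul, map_smul, norm_smul, norm_inv, norm_norm, inv_mul_le_iff₀ hn] at this
    linarith
  set N := k * j + l with hN
  have hN1 : 1 ≤ N := by omega
  have hhalf : ∀ f ∈ V, ‖(A ^ N) f‖ ≤ 1 / 2 * ‖f‖ := by
    intro f hf
    have e : (A ^ N) f = (A ^ (k * j)) ((A ^ l) f) := by rw [hN, pow_add]; rfl
    rw [e]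
    calc _ ≤ β ^ j * ‖(A ^ l) f‖ + C' * ‖ι ((A ^ l) f)‖ :=
          norm_pow_mul_le_of_lasotaYorke hA hβ hβ1 hC hLY j _
      _ ≤ 1 / (4 * B') * (B' * ‖f‖) + C' * (1 / (4 * C') * ‖f‖) := by
          gcongr
          · exact hBn l f
          · exact hweak f hf
      _ = 1 / 2 * ‖f‖ := by field_simp; ring
  have hiter : ∀ (i : ℕ), ∀ f ∈ V, ‖(A ^ (N * i)) f‖ ≤ (1 / 2) ^ i * ‖f‖ := by
    intro i f hf
    induction i with
    | zero => simp
    | succ i ih =>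
      have e : (A ^ (N * (i + 1))) f = (A ^ N) ((A ^ (N * i)) f) := by
        rw [mul_add, mul_one, add_comm, pow_add]; rfl
      rw [e]
      refine (hhalf _ (hVn _ f hf)).trans ?_
      rw [pow_succ', mul_assoc]
      exact mul_le_mul_of_nonneg_left ih (by norm_num)
  set r : ℝ := (1 / 2 : ℝ) ^ (1 / N : ℝ) with hr
  have hN0 : (0 : ℝ) < N := by exact_mod_cast hN1
  have hr0 : 0 < r := by positivity
  have hr1 : r < 1 := Real.rpow_lt_one (by norm_num) (by norm_num) (by positivity)
  have hrN : r ^ N = 1 / 2 := by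
    rw [hr, ← Real.rpow_natCast, ← Real.rpow_mul (by norm_num), one_div_mul_cancel hN0.ne',
      Real.rpow_one]
  refine ⟨2 * B', r, by positivity, hr0, hr1, fun f hf n => ?_⟩
  have e : (A ^ n) f = (A ^ (n % N)) ((A ^ (N * (n / N))) f) := by
    conv_lhs => rw [← Nat.mod_add_div n N, pow_add]
    rfl
  -- As `r ^ N = 1 / 2`, ignoring the remaining `n % N < N` steps costs at most a factor 2.
  have h2 : (1 / 2 : ℝ) ^ (n / N) ≤ 2 * r ^ n := by
    have h3 : (1 / 2 : ℝ) ^ (n / N) * r ^ (n % N) = r ^ n := by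
      conv_rhs => rw [← Nat.mod_add_div n N, pow_add, pow_mul, hrN]
      ring
    have h4 : 1 / 2 ≤ r ^ (n % N) := by
      rw [← hrN]
      exact pow_le_pow_of_le_one hr0.le hr1.le (Nat.mod_lt _ hN1).le
    rw [← h3]
    have : (0 : ℝ) < (1 / 2) ^ (n / N) := by positivity
    nlinarith
  rw [e]
  calc _ ≤ B' * ‖(A ^ (N * (n / N))) f‖ := hBn _ _
    _ ≤ B' * ((1 / 2) ^ (n / N) * ‖f‖) := by gcongr; exact hiter _ f hf
    _ ≤ B' * (2 * r ^ n * ‖f‖) := by gcongr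
    _ = 2 * B' * r ^ n * ‖f‖ := by ring

end SpectralGap

/-! ### The Perron–Frobenius operator on the strong space -/

section StrongSpace

variable {X : Type*} [MeasurableSpace X] {m : Measure X} [IsFiniteMeasure m] {T : X → X}
  {S : Type*} [NormedAddCommGroup S] [NormedSpace ℝ S] {ι : S →ₗ[ℝ] (X →₁[m] ℝ)} {PS : S →L[ℝ] S}

lemma setIntegral_pow (hT : Measure.QuasiMeasurePreserving T m m)
    (hS : IsStrongSpace T ι PS) (n : ℕ) (f : S) {A : Set X} (hA : MeasurableSet A) :
    ∫ x in A, ι ((PS ^ n) f) x ∂m = ∫ x in T^[n] ⁻¹' A, ι f x ∂m := by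
  induction n generalizing A with
  | zero => simp
  | succ n ih =>
    have e : (PS ^ (n + 1)) f = PS ((PS ^ n) f) := by rw [pow_succ']; rfl
    rw [e, hS.invariant, setIntegral_perronFrobenius hT _ hA, ih (hT.measurable hA),
      Function.iterate_succ', preimage_comp]

/-- The integral of the density, as a linear functional. -/
noncomputable def massFunctional (ι : S →ₗ[ℝ] (X →₁[m] ℝ)) : S →ₗ[ℝ] ℝ where
  toFun f := ∫ x, ι f x ∂m
  map_add' f g := by
    rw [map_add, ← integral_add (L1.integrable_coeFn _) (L1.integrable_coeFn _)]
    exact integral_congr_ae (Lp.coeFn_add _ _)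
  map_smul' c f := by
    rw [map_smul, RingHom.id_apply, smul_eq_mul, ← integral_const_mul]
    exact integral_congr_ae (Lp.coeFn_smul _ _)

lemma massFunctional_apply (f : S) : massFunctional ι f = ∫ x, ι f x ∂m := rfl

lemma abs_massFunctional_le (hS : IsStrongSpace T ι PS) (f : S) : |massFunctional ι f| ≤ ‖f‖ := by
  refine le_trans ?_ (hS.norm_le f)
  rw [L1.norm_eq_integral_norm, massFunctional_apply, ← Real.norm_eq_abs]
  exact norm_integral_le_integral_norm _

lemma massFunctional_pow (hT : Measure.QuasiMeasurePreserving T m m)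
    (hS : IsStrongSpace T ι PS) (n : ℕ) (f : S) :
    massFunctional ι ((PS ^ n) f) = massFunctional ι f := by
  have := setIntegral_pow hT hS n f MeasurableSet.univ
  simpa [massFunctional_apply] using this

lemma norm_eq_massFunctional {f : S} (hf : 0 ≤ᵐ[m] ι f) : ‖ι f‖ = massFunctional ι f := by
  rw [L1.norm_eq_integral_norm, massFunctional_apply]
  refine integral_congr_ae ?_
  filter_upwards [hf] with x hx
  exact (Real.norm_eq_abs _).trans (abs_of_nonneg hx)

lemma ae_abs_le_of_dominatesLInf {H : ℝ} (hH : 0 ≤ H)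
    (hN : ∀ f, eLpNorm (ι f) ∞ m ≤ ENNReal.ofReal (H * ‖f‖)) (f : S) :
    ∀ᵐ x ∂m, |ι f x| ≤ H * ‖f‖ := by
  have h := hN f
  rw [eLpNorm_exponent_top] at h
  filter_upwards [enorm_ae_le_eLpNormEssSup (ι f) m] with x hx
  have := hx.trans h
  rw [← ofReal_norm, ENNReal.ofReal_le_ofReal_iff (by positivity)] at this
  exact this

lemma tendsto_pow_of_nonneg {ψ₀ : S}
    (hψ : ∀ ψ, IsDensity (ι ψ) → Tendsto (fun n : ℕ => (PS ^ n) (ψ₀ - ψ)) atTop (𝓝 0))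
    (hinv : PS ψ₀ = ψ₀)
    {f : S} (hf : 0 ≤ᵐ[m] ι f) (hpos : 0 < massFunctional ι f) :
    Tendsto (fun n : ℕ => (PS ^ n) f) atTop (𝓝 (massFunctional ι f • ψ₀)) := by
  set t := massFunctional ι f with ht
  have hdens : IsDensity (ι (t⁻¹ • f)) := by
    refine ⟨?_, ?_⟩
    · rw [map_smul]
      filter_upwards [hf, Lp.coeFn_smul t⁻¹ (ι f)] with x hx hx'
      rw [hx', Pi.smul_apply, Pi.zero_apply]
      exact smul_nonneg (by positivity) hx
    · rw [map_smul, norm_smul, norm_eq_massFunctional hf, Real.norm_eq_abs,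
        abs_of_pos (by positivity), ← ht, inv_mul_cancel₀ hpos.ne']
  have hn : ∀ n : ℕ, (PS ^ n) ψ₀ = ψ₀ := by
    intro n
    induction n with
    | zero => simp
    | succ n ih => rw [pow_succ]; exact (congrArg _ hinv).trans ih
  have h1 := ((hψ _ hdens).const_smul t).const_sub (t • ψ₀)
  rw [smul_zero, sub_zero] at h1
  refine h1.congr fun n => ?_
  rw [map_sub, hn, map_smul, smul_sub, smul_smul, mul_inv_cancel₀ hpos.ne', one_smul]
  abel

/-- Positive and negative parts of `f` may leave `S`. Instead `f = (f + c) - c` with a large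
constant `c`: both terms are nonnegative, since `S` contains constants and its norm dominates the
sup norm. -/
lemma tendsto_pow {H : ℝ} (hH : 0 ≤ H)
    (hN : ∀ f, eLpNorm (ι f) ∞ m ≤ ENNReal.ofReal (H * ‖f‖)) {e : S}
    (he : (ι e : X → ℝ) =ᵐ[m] fun _ => 1) {ψ₀ : S}
    (hψ : ∀ ψ, IsDensity (ι ψ) → Tendsto (fun n : ℕ => (PS ^ n) (ψ₀ - ψ)) atTop (𝓝 0))
    (hinv : PS ψ₀ = ψ₀) (hm : 0 < massFunctional ι e) (f : S) :
    Tendsto (fun n : ℕ => (PS ^ n) f) atTop (𝓝 (massFunctional ι f • ψ₀)) := by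
  have he0 : 0 ≤ᵐ[m] ι e := by
    filter_upwards [he] with x hx
    rw [hx]; exact zero_le_one
  set s := massFunctional ι e with hs
  -- The first summand makes `f + c • e` nonnegative, the second makes its mass at least 1.
  set c := H * ‖f‖ + (|massFunctional ι f| + 1) / s with hc
  have hc1 : H * ‖f‖ ≤ c := by
    rw [hc]
    linarith [show 0 ≤ (|massFunctional ι f| + 1) / s by positivity]
  have hg0 : 0 ≤ᵐ[m] ι (f + c • e) := by
    rw [map_add, map_smul]
    filter_upwards [he, ae_abs_le_of_dominatesLInf hH hN f, Lp.coeFn_add (ι f) (c • ι e),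
      Lp.coeFn_smul c (ι e)] with x h1 h2 h3 h4
    rw [h3, Pi.add_apply, h4, Pi.smul_apply, h1, Pi.zero_apply, smul_eq_mul]
    have := (abs_le.1 h2).1
    linarith
  have hgm : massFunctional ι (f + c • e) = massFunctional ι f + c * s := by
    rw [map_add, map_smul, smul_eq_mul]
  have hcs : |massFunctional ι f| + 1 ≤ c * s := by
    rw [hc, add_mul, div_mul_cancel₀ _ hm.ne']
    have : 0 ≤ H * ‖f‖ * s := by positivity
    linarith
  have hgpos : 0 < massFunctional ι (f + c • e) := by
    rw [hgm]
    linarith [neg_abs_le (massFunctional ι f)]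
  have h1 := tendsto_pow_of_nonneg hψ hinv hg0 hgpos
  have h2 := (tendsto_pow_of_nonneg hψ hinv he0 hm).const_smul c
  have h3 := h1.sub h2
  rw [hgm, smul_smul, ← sub_smul, add_sub_cancel_right] at h3
  refine h3.congr fun n => ?_
  rw [map_add, map_smul, add_sub_cancel_right]

/-- Spectral gap of the Perron-Frobenius operator of the base map. -/
lemma exists_spectralGap [CompleteSpace S] (hT : Measure.QuasiMeasurePreserving T m m)
    (hS : IsStrongSpace T ι PS) (hN : DominatesLInf ι)
    (hone : ∃ e : S, (ι e : X → ℝ) =ᵐ[m] fun _ => 1) :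
    (∃ B : ℝ, ∀ (n : ℕ) f, ‖(PS ^ n) f‖ ≤ B * ‖f‖) ∧
    ∃ D r : ℝ, 0 < D ∧ 0 < r ∧ r < 1 ∧
      ∀ f, massFunctional ι f = 0 → ∀ n : ℕ, ‖(PS ^ n) f‖ ≤ D * r ^ n * ‖f‖ := by
  obtain ⟨H, hH, hN⟩ := hN
  obtain ⟨e, he⟩ := hone
  obtain ⟨ψ₀, ⟨hd, hinv⟩, -, hψ⟩ := hS.equilibrium
  have hm : 0 < massFunctional ι e := by
    rw [massFunctional_apply, integral_congr_ae he, integral_const, smul_eq_mul, mul_one]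
    -- If `m` were zero, no density could have norm one, against the existence of `ψ₀`.
    refine measureReal_nonneg.lt_of_ne' fun h0 => ?_
    have h0' : m = 0 := by simpa [Measure.real, ENNReal.toReal_eq_zero_iff] using h0
    have h1 := hd.2
    rw [L1.norm_eq_integral_norm] at h1
    have : ∫ x, ‖ι ψ₀ x‖ ∂m = 0 := by
      have hz : ae m = ⊥ := ae_eq_bot.2 h0'
      rw [integral_congr_ae (g := fun _ => 0) (by rw [EventuallyEq, hz]; exact eventually_bot),
        integral_zero]
    linarith
  have hlim := tendsto_pow hH hN he hψ hinv hm
  -- Convergent orbits are bounded, and the uniform boundedness principle applies.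
  have hB : ∃ B : ℝ, ∀ (n : ℕ) f, ‖(PS ^ n) f‖ ≤ B * ‖f‖ := by
    obtain ⟨B, hB⟩ := banach_steinhaus (g := fun n : ℕ => PS ^ n) fun f => by
      obtain ⟨C, hC⟩ := (hlim f).norm.bddAbove_range
      exact ⟨C, fun n => hC (mem_range_self n)⟩
    exact ⟨B, fun n f => (PS ^ n).le_of_opNorm_le (hB n) f⟩
  refine ⟨hB, ?_⟩
  obtain ⟨B, hB⟩ := hB
  obtain ⟨D, r, hD, hr, hr1, h⟩ := exists_exponential_decay hS.norm_le
    (fun f => by rw [hS.invariant]; exact norm_perronFrobenius_le hT _)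
    hS.relativelyCompact hS.lasotaYorke hB (LinearMap.ker (massFunctional ι))
    (fun f hf => by
      have := massFunctional_pow hT hS 1 f
      rw [pow_one] at this
      rw [LinearMap.mem_ker] at hf ⊢
      rw [this, hf])
    (fun f hf => by
      have := hlim f
      rwa [LinearMap.mem_ker.1 hf, zero_smul] at this)
  exact ⟨D, r, hD, hr, hr1, fun f hf n => h f hf n⟩

/-- The iterates of the base map do not expand measures by more than a constant. -/
lemma exists_measureReal_preimage_iterate_le (hT : Measure.QuasiMeasurePreserving T m m)
    (hS : IsStrongSpace T ι PS) (hN : DominatesLInf ι)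
    (hone : ∃ e : S, (ι e : X → ℝ) =ᵐ[m] fun _ => 1) {B : ℝ}
    (hB : ∀ (n : ℕ) f, ‖(PS ^ n) f‖ ≤ B * ‖f‖) :
    ∃ M : ℝ, 0 < M ∧ ∀ (n : ℕ) (A : Set X), MeasurableSet A →
      m.real (T^[n] ⁻¹' A) ≤ M * m.real A := by
  obtain ⟨H, hH, hN⟩ := hN
  obtain ⟨e, he⟩ := hone
  -- `(PS ^ n) e` is the density of the image of `m` under `T^[n]`, and `H * (B * ‖e‖)` bounds it
  -- for every `n`. The maximum with 1 only ensures positivity.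
  refine ⟨max (H * (B * ‖e‖)) 1, by positivity, fun n A hA => ?_⟩
  have h1 : ∫ x in A, ι ((PS ^ n) e) x ∂m = m.real (T^[n] ⁻¹' A) := by
    rw [setIntegral_pow hT hS n e hA, integral_congr_ae (ae_restrict_of_ae he), setIntegral_const,
      smul_eq_mul, mul_one]
  rw [← h1]
  refine (le_abs_self _).trans ?_
  rw [← Real.norm_eq_abs]
  refine norm_setIntegral_le_of_norm_le_const_ae (measure_lt_top m A) (ae_restrict_of_ae ?_)
  filter_upwards [ae_abs_le_of_dominatesLInf hH hN ((PS ^ n) e)] with x hx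
  rw [Real.norm_eq_abs]
  exact hx.trans ((mul_le_mul_of_nonneg_left (hB n e) hH).trans (le_max_left _ _))

end StrongSpace

/-! ### Weak limits of measures and of kernels -/

section WeakLimits

variable {Y : Type*} [MetricSpace Y] [CompactSpace Y] [MeasurableSpace Y] [BorelSpace Y]

/-- Lipschitz functions determine weak convergence, and on a compact space each is a multiple of a
test function. -/
lemma tendsto_of_forall_testFunctions {P : ℕ → ProbabilityMeasure Y} {Q : ProbabilityMeasure Y}
    (h : ∀ g ∈ testFunctions Y,
      Tendsto (fun n => ∫ y, g y ∂(P n : Measure Y)) atTop (𝓝 (∫ y, g y ∂(Q : Measure Y)))) :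
    Tendsto P atTop (𝓝 Q) := by
  refine tendsto_iff_forall_lipschitz_integral_tendsto.2 ?_
  rintro f - ⟨L, hL⟩
  obtain ⟨K, hK⟩ := isCompact_univ.exists_bound_of_continuousOn hL.continuous.continuousOn
  set t : ℝ := L + |K| + 1 with ht
  have ht0 : 0 < t := by positivity
  have hK' : ∀ y, |f y| ≤ |K| := fun y => (hK y (mem_univ y)).trans (le_abs_self K)
  let g : C(Y, ℝ) := ⟨fun y => f y / t, hL.continuous.div_const t⟩
  have hg : g ∈ testFunctions Y := by
    refine ⟨LipschitzWith.of_dist_le_mul fun x y => ?_, fun y => ?_⟩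
    · change dist (f x / t) (f y / t) ≤ _
      rw [Real.dist_eq, ← sub_div, abs_div, abs_of_pos ht0, div_le_iff₀ ht0, ← Real.dist_eq,
        NNReal.coe_one, one_mul, mul_comm]
      refine (hL.dist_le_mul x y).trans (mul_le_mul_of_nonneg_right ?_ dist_nonneg)
      linarith [abs_nonneg K]
    · change |f y / t| ≤ 1
      rw [abs_div, abs_of_pos ht0, div_le_iff₀ ht0, one_mul]
      linarith [hK' y, L.coe_nonneg]
  have hfg : ∀ ρ : Measure Y, ∫ y, f y ∂ρ = t * ∫ y, g y ∂ρ := by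
    intro ρ
    rw [← integral_const_mul]
    refine integral_congr_ae (.of_forall fun y => ?_)
    change f y = t * (f y / t)
    field_simp
  simp only [hfg]
  exact (h g hg).const_mul t

/-- A sequence of probability measures that is geometrically Cauchy for `wDist` converges
weakly. -/
lemma exists_tendsto_of_wDist_le (P : ℕ → ProbabilityMeasure Y) {C α : ℝ} (hC : 0 ≤ C)
    (hα : 0 ≤ α) (hα1 : α < 1)
    (h : ∀ n, wDist (P (n + 1) : Measure Y) (P n : Measure Y) ≤ ENNReal.ofReal (C * α ^ n)) :
    ∃ Q, Tendsto P atTop (𝓝 Q) := by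
  -- Compactness supplies the limit along a subsequence; the Cauchy property of each integral
  -- extends the convergence to the whole sequence.
  obtain ⟨Q, φ, hφ, hQ⟩ := CompactSpace.tendsto_subseq P
  refine ⟨Q, tendsto_of_forall_testFunctions fun g hg => ?_⟩
  have hc : CauchySeq fun n => ∫ y, g y ∂(P n : Measure Y) := by
    refine cauchySeq_of_le_geometric α C hα1 fun n => ?_
    rw [dist_comm, Real.dist_eq, ← ENNReal.ofReal_le_ofReal_iff (by positivity)]
    exact (le_iSup_of_le (⟨g, hg⟩ : {g : Y → ℝ // LipschitzWith 1 g ∧ ∀ y, |g y| ≤ 1})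
      le_rfl).trans (h n)
  refine tendsto_nhds_of_cauchySeq_of_subseq hc hφ.tendsto_atTop ?_
  exact ProbabilityMeasure.tendsto_iff_forall_integral_tendsto.1 hQ
    (BoundedContinuousFunction.mkOfCompact g)

lemma tendsto_integral_of_continuous {P : ℕ → ProbabilityMeasure Y} {Q : ProbabilityMeasure Y}
    (h : Tendsto P atTop (𝓝 Q)) {g : Y → ℝ} (hg : Continuous g) :
    Tendsto (fun n => ∫ y, g y ∂(P n : Measure Y)) atTop (𝓝 (∫ y, g y ∂(Q : Measure Y))) :=
  ProbabilityMeasure.tendsto_iff_forall_integral_tendsto.1 h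
    (BoundedContinuousFunction.mkOfCompact ⟨g, hg⟩)

/-- An almost everywhere weak limit of Markov kernels is a Markov kernel. -/
lemma exists_kernel_tendsto [Nonempty Y] {X : Type*} [MeasurableSpace X] {l : Measure X}
    (κ : ℕ → Kernel X Y) [∀ n, IsMarkovKernel (κ n)]
    (h : ∀ᵐ x ∂l, ∃ Q : ProbabilityMeasure Y, ∀ g : Y → ℝ, Continuous g →
      Tendsto (fun n => ∫ y, g y ∂(κ n x)) atTop (𝓝 (∫ y, g y ∂(Q : Measure Y)))) :
    ∃ K : Kernel X Y, IsMarkovKernel K ∧ ∀ᵐ x ∂l, ∀ g : Y → ℝ, Continuous g →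
      Tendsto (fun n => ∫ y, g y ∂(κ n x)) atTop (𝓝 (∫ y, g y ∂(K x))) := by
  classical
  obtain ⟨y₀⟩ := id ‹Nonempty Y›
  set B := {x | ¬ ∃ Q : ProbabilityMeasure Y, ∀ g : Y → ℝ, Continuous g →
      Tendsto (fun n => ∫ y, g y ∂(κ n x)) atTop (𝓝 (∫ y, g y ∂(Q : Measure Y)))} with hB
  -- The convergence set need not be measurable. `E` is a measurable part of it of full measure, and
  -- off `E` the kernel is a Dirac mass.
  set E := (toMeasurable l B)ᶜ with hE
  have hEm : MeasurableSet E := (measurableSet_toMeasurable l B).compl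
  have hEs : ∀ x ∈ E, ∃ Q : ProbabilityMeasure Y, ∀ g : Y → ℝ, Continuous g →
      Tendsto (fun n => ∫ y, g y ∂(κ n x)) atTop (𝓝 (∫ y, g y ∂(Q : Measure Y))) := fun x hx => by
    by_contra hxB
    exact hx (subset_toMeasurable l B hxB)
  have hE0 : l Eᶜ = 0 := by
    rw [hE, compl_compl, measure_toMeasurable]
    exact h
  let K : X → Measure Y := fun x =>
    if hx : x ∈ E then ((hEs x hx).choose : Measure Y) else Measure.dirac y₀
  have hKp : ∀ x, IsProbabilityMeasure (K x) := fun x => by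
    by_cases hx : x ∈ E
    · simp only [K, hx, dif_pos]; infer_instance
    · simp only [K, hx, dif_neg, not_false_eq_true]; infer_instance
  have hKlim : ∀ x ∈ E, ∀ g : Y → ℝ, Continuous g →
      Tendsto (fun n => ∫ y, g y ∂(κ n x)) atTop (𝓝 (∫ y, g y ∂(K x))) := by
    intro x hx g hg
    simp only [K, hx, dif_pos]
    exact (hEs x hx).choose_spec g hg
  have hKint : ∀ g : Y → ℝ, Continuous g → Measurable fun x => ∫ y, g y ∂(K x) := by
    intro g hg
    have hκ : ∀ n, Measurable fun x => ∫ y, g y ∂(κ n x) := fun n =>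
      (StronglyMeasurable.integral_kernel (hg.measurable.stronglyMeasurable)).measurable
    refine measurable_of_tendsto_metrizable
      (f := fun n x => if x ∈ E then ∫ y, g y ∂(κ n x) else g y₀)
      (fun n => Measurable.ite hEm (hκ n) measurable_const) ?_
    rw [tendsto_pi_nhds]
    intro x
    by_cases hx : x ∈ E
    · simp only [hx, if_true]
      exact hKlim x hx g hg
    · simp only [hx, if_false, K, dif_neg, not_false_eq_true, integral_dirac]
      exact tendsto_const_nhds
  -- Closed sets generate the σ-algebra, and their indicators are limits of continuous thickened
  -- indicators, so `hKint` suffices.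
  have hKm : Measurable K := by
    refine Measurable.measure_of_isPiSystem_of_isProbabilityMeasure
      (S := {s : Set Y | IsClosed s}) ?_ isPiSystem_isClosed ?_
    · rw [BorelSpace.measurable_eq (α := Y), borel_eq_generateFrom_isClosed]
    · intro F hF
      have hpos : ∀ n : ℕ, (0 : ℝ) < 1 / ((n : ℝ) + 1) := fun n => by positivity
      have hr : Measurable fun x => (K x).real F := by
        refine measurable_of_tendsto_metrizable
          (f := fun n x => ∫ y, (thickenedIndicator (hpos n) F y : ℝ) ∂(K x))
          (fun n => hKint _ (by fun_prop)) ?_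
        rw [tendsto_pi_nhds]
        exact fun x => tendsto_integral_thickenedIndicator_of_isClosed (K x) hF hpos
          tendsto_one_div_add_atTop_nhds_zero_nat
      have e : (fun x => K x F) = fun x => ENNReal.ofReal ((K x).real F) := by
        funext x
        rw [ofReal_measureReal]
      rw [e]
      exact hr.ennreal_ofReal
  refine ⟨⟨K, hKm⟩, ⟨hKp⟩, ?_⟩
  have hEae : ∀ᵐ x ∂l, x ∈ E := hE0
  filter_upwards [hEae] with x hx using hKlim x hx

end WeakLimits

/-! ### Lifting an invariant measure from the base -/

section InvariantMeasure

variable {X Y : Type*} [MeasurableSpace X] [MetricSpace Y] [CompactSpace Y] [MeasurableSpace Y]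
  [BorelSpace Y] [Nonempty Y] {l : Measure X} [IsFiniteMeasure l]

lemma leafRestrict_eq_condKernel {p : Measure (X × Y)} [IsFiniteMeasure p] (hp : p.fst = l) :
    ∀ᵐ x ∂l, leafRestrict l p x = p.condKernel x := by
  filter_upwards [Measure.rnDeriv_self l] with x hx
  rw [leafRestrict, hp, hx, one_smul]

lemma wDist_le_of_isProbabilityMeasure {Y : Type*} [MetricSpace Y] [CompactSpace Y]
    [MeasurableSpace Y] [BorelSpace Y] (p q : Measure Y)
    [IsProbabilityMeasure p] [IsProbabilityMeasure q] : wDist p q ≤ ENNReal.ofReal 2 := by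
  refine iSup_le fun g => ENNReal.ofReal_le_ofReal ?_
  have h : ∀ ρ : Measure Y, IsProbabilityMeasure ρ → |∫ y, g.1 y ∂ρ| ≤ 1 := fun ρ _ => by
    have := norm_integral_le_of_norm_le_const (μ := ρ) (f := g.1) (C := 1) (.of_forall g.2.2)
    simpa using this
  have h1 := h p inferInstance
  have h2 := h q inferInstance
  have := abs_sub (∫ y, g.1 y ∂p) (∫ y, g.1 y ∂q)
  linarith

/-- A fibre-contracting skew product over a measure preserving map has an invariant measure with
the given marginal. -/
lemma exists_invariant_measure {T : X → X} {G : X × Y → Y} (hT : MeasurePreserving T l l)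
    (hG : Measurable G) (hdiam : ∀ y₁ y₂ : Y, dist y₁ y₂ ≤ 1) {α : ℝ} (hα : 0 < α) (hα1 : α < 1)
    (hcontr : ∀ x y₁ y₂, dist (G (x, y₁)) (G (x, y₂)) ≤ α * dist y₁ y₂) :
    ∃ μ : Measure (X × Y), IsFiniteMeasure μ ∧ μ.fst = l ∧ μ.map (skewProduct T G) = μ := by
  obtain ⟨y₀⟩ := id ‹Nonempty Y›
  set F := skewProduct T G with hF
  have hFm : Measurable F := measurable_skewProduct hT.measurable hG
  let ρ : ℕ → Measure (X × Y) := fun n => (l.prod (Measure.dirac y₀)).map F^[n]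
  have hfin : ∀ n, IsFiniteMeasure (ρ n) := fun n => by
    simp only [ρ]; infer_instance
  have hsucc : ∀ n, ρ (n + 1) = (ρ n).map F := fun n => by
    simp only [ρ]
    rw [Measure.map_map hFm (hFm.iterate n), Function.iterate_succ']
  have hadd : ∀ n j, ρ (j + n) = (ρ j).map F^[n] := fun n j => by
    simp only [ρ]
    rw [Measure.map_map (hFm.iterate n) (hFm.iterate j), add_comm j n, Function.iterate_add]
  have hfst : ∀ n, (ρ n).fst = l := by
    intro n
    induction n with
    | zero => simp [ρ]
    | succ n ih => rw [hsucc, hF, fst_map_skewProduct hT.measurable hG, ih, hT.map_eq]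
  have hac : ∀ n, (ρ n).fst ≪ l := fun n => by rw [hfst]
  have hw01 : ∀ᵐ x ∂l, wDist (leafRestrict l (ρ 1) x) (leafRestrict l (ρ 0) x) ≤
      ENNReal.ofReal 2 := by
    filter_upwards [leafRestrict_eq_condKernel (hfst 1), leafRestrict_eq_condKernel (hfst 0)]
      with x h1 h0
    rw [h1, h0]
    exact wDist_le_of_isProbabilityMeasure _ _
  -- `ρ (n + 1)` and `ρ n` are the images of `ρ 1` and `ρ 0` under `F^[n]`, which contracts leaves
  -- by `α ^ n`. The marginals agree, so `b = 0`, and `c = 2` is the trivial bound between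
  -- probability measures.
  have hcauchy : ∀ n, ∀ᵐ x ∂l, wDist ((ρ (n + 1)).condKernel x) ((ρ n).condKernel x) ≤
      ENNReal.ofReal (2 * α ^ n) := by
    intro n
    have : ∀ᵐ x ∂l, wDist (leafRestrict l (ρ (n + 1)) x) (leafRestrict l (ρ n) x) ≤
        ENNReal.ofReal (2 * α ^ n) := by
      refine ae_wDist_leafRestrict_le (hac _) (hac _) fun g hg A hA => ?_
      have hgm : Measurable fun z : X × Y => g z.2 := g.continuous.measurable.comp measurable_snd
      have hTn := hT.measurable.iterate n
      have hGn : Measurable fun z => (F^[n] z).2 := measurable_snd.comp (hFm.iterate n)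
      have e1 : ρ (n + 1) = (ρ 1).map (skewProduct T^[n] fun z => (F^[n] z).2) := by
        rw [add_comm, hadd n 1, hF, ← iterate_skewProduct]
      have e0 : ρ n = (ρ 0).map (skewProduct T^[n] fun z => (F^[n] z).2) := by
        conv_lhs => rw [← zero_add n, hadd n 0, hF, iterate_skewProduct]
      rw [e1, e0, setIntegral_map_skewProduct hTn hGn _ hgm hA,
        setIntegral_map_skewProduct hTn hGn _ hgm hA]
      refine (abs_setIntegral_sub_le (hac 1) (hac 0) hdiam (α := α ^ n) (c := 2) (b := 0)
        (by positivity) (by norm_num) hw01 (.of_forall fun x => by rw [hfst, hfst]; simp)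
        (hgm.comp (measurable_skewProduct hTn hGn)) ?_ (fun z => hg.2 _) (hTn hA)).trans ?_
      · intro x y₁ y₂
        refine le_trans ?_ (dist_iterate_skewProduct_le T hα hcontr n x y₁ y₂)
        have := hg.1.dist_le_mul (F^[n] (x, y₁)).2 (F^[n] (x, y₂)).2
        rwa [Real.dist_eq, NNReal.coe_one, one_mul] at this
      · rw [(hT.iterate n).measureReal_preimage hA.nullMeasurableSet]
        exact le_of_eq (by ring)
    filter_upwards [this, leafRestrict_eq_condKernel (hfst (n + 1)),
      leafRestrict_eq_condKernel (hfst n)] with x h h1 h0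
    rwa [h1, h0] at h
  obtain ⟨K, hK, hKlim⟩ := exists_kernel_tendsto (l := l) (fun n => (ρ n).condKernel) (by
    filter_upwards [ae_all_iff.2 hcauchy] with x hx
    obtain ⟨Q, hQ⟩ := exists_tendsto_of_wDist_le
      (fun n => (⟨(ρ n).condKernel x, inferInstance⟩ : ProbabilityMeasure Y))
      (C := 2) (by norm_num) hα.le hα1 hx
    exact ⟨Q, fun g hg => tendsto_integral_of_continuous hQ hg⟩)
  -- Continuity is required only along leaves: weak convergence on almost every leaf and dominated
  -- convergence in `x` do the rest.
  have hlim : ∀ h : X × Y → ℝ, Measurable h → (∀ x, Continuous fun y => h (x, y)) →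
      ∀ b : ℝ, (∀ z, |h z| ≤ b) →
        Tendsto (fun n => ∫ z, h z ∂(ρ n)) atTop (𝓝 (∫ z, h z ∂(l ⊗ₘ K))) := by
    intro h hm hc b hb
    have hi : ∀ r : Measure (X × Y), IsFiniteMeasure r → Integrable h r := fun r _ =>
      Integrable.of_bound hm.aestronglyMeasurable b (.of_forall hb)
    rw [Measure.integral_compProd (hi _ inferInstance)]
    have e : ∀ n, ∫ z, h z ∂(ρ n) = ∫ x, ∫ y, h (x, y) ∂((ρ n).condKernel x) ∂l := fun n => by
      rw [← Measure.integral_condKernel (hi _ inferInstance), hfst]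
    simp only [e]
    refine tendsto_integral_of_dominated_convergence (fun _ => b) (fun n => ?_)
      (integrable_const _) (fun n => .of_forall fun x => ?_) ?_
    · exact (StronglyMeasurable.integral_kernel_prod_right'
        (κ := (ρ n).condKernel) hm.stronglyMeasurable).aestronglyMeasurable
    · have := norm_integral_le_of_norm_le_const (μ := (ρ n).condKernel x)
        (f := fun y => h (x, y)) (C := b) (.of_forall fun y => hb _)
      simpa using this
    · filter_upwards [hKlim] with x hx using hx _ (hc x)
  refine ⟨l ⊗ₘ K, inferInstance, Measure.fst_compProd l K, ?_⟩
  have hGc : ∀ x, Continuous fun y => G (x, y) := fun x =>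
    (LipschitzWith.of_dist_le_mul (K := ⟨α, hα.le⟩) (hcontr x)).continuous
  -- `F` is continuous along leaves, so `h ∘ F` is again admissible in `hlim`, and `ρ (n + 1) = (ρ
  -- n).map F` passes to the limit.
  have hinv : ∀ A, MeasurableSet A → ∀ g : C(Y, ℝ),
      ∫ z in A ×ˢ univ, g z.2 ∂((l ⊗ₘ K).map F) = ∫ z in A ×ˢ univ, g z.2 ∂(l ⊗ₘ K) := by
    intro A hA g
    have hgm : Measurable fun z : X × Y => g z.2 := g.continuous.measurable.comp measurable_snd
    have hAu : MeasurableSet (A ×ˢ (univ : Set Y)) := hA.prod MeasurableSet.univ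
    set h : X × Y → ℝ := (A ×ˢ univ).indicator fun z => g z.2 with hh
    have hhm : Measurable h := hgm.indicator hAu
    have hhx : ∀ x y, h (x, y) = A.indicator (fun _ => g y) x := fun x y => by
      by_cases hx : x ∈ A <;> simp [hh, hx]
    have hhc : ∀ x, Continuous fun y => h (x, y) := fun x => by
      simp only [hhx]
      by_cases hx : x ∈ A
      · simpa [hx] using g.continuous
      · simpa [hx] using continuous_const
    have hhb : ∀ z, |h z| ≤ ‖g‖ := fun z => by
      by_cases hz : z ∈ A ×ˢ (univ : Set Y)
      · rw [hh, indicator_of_mem hz]; exact g.norm_coe_le_norm _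
      · rw [hh, indicator_of_notMem hz]; simp
    rw [← integral_indicator hAu, ← integral_indicator hAu, ← hh,
      integral_map hFm.aemeasurable hhm.aestronglyMeasurable]
    have h1 := hlim h hhm hhc _ hhb
    have h2 := hlim (fun z => h (F z)) (hhm.comp hFm)
      (fun x => (hhc (T x)).comp (hGc x)) _ fun z => hhb _
    refine tendsto_nhds_unique h2 (((tendsto_add_atTop_iff_nat 1).2 h1).congr fun n => ?_)
    rw [hsucc, integral_map hFm.aemeasurable hhm.aestronglyMeasurable]
  -- For fixed `A`, the slice over `A` is a finite measure on `Y`, determined by its integrals of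
  -- continuous functions.
  refine Measure.ext_prod fun {A B} hA hB => ?_
  set slice : Measure (X × Y) → Measure Y := fun p => (p.restrict (A ×ˢ univ)).map Prod.snd
  have hslice : ∀ p : Measure (X × Y), slice p B = p (A ×ˢ B) := fun p => by
    simp only [slice]
    rw [Measure.map_apply measurable_snd hB, Measure.restrict_apply (measurable_snd hB)]
    congr 1
    ext z
    simp [and_comm]
  have hint : ∀ (p : Measure (X × Y)) (g : C(Y, ℝ)),
      ∫ y, g y ∂(slice p) = ∫ z in A ×ˢ univ, g z.2 ∂p := fun p g =>
    integral_map measurable_snd.aemeasurable g.continuous.measurable.aestronglyMeasurable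
  rw [← hslice, ← hslice]
  have hsf : ∀ p : Measure (X × Y), IsFiniteMeasure p → IsFiniteMeasure (slice p) := fun p _ => by
    simp only [slice]; infer_instance
  have := hsf _ (inferInstance : IsFiniteMeasure ((l ⊗ₘ K).map F))
  have := hsf _ (inferInstance : IsFiniteMeasure (l ⊗ₘ K))
  congr 1
  refine ext_of_forall_integral_eq_of_IsFiniteMeasure fun g => ?_
  exact (hint _ g.toContinuousMap).trans
    ((hinv A hA g.toContinuousMap).trans (hint _ g.toContinuousMap).symm)

end InvariantMeasure

/-! ### Splitting off a rank one projection -/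

section RankOne

/-- A linear map with a fixed vector `μ₀` and an invariant functional `f`, `f μ₀ = 1`, that decays
exponentially on the kernel of `f`, splits into a rank one projection and a decaying part. -/
lemma exists_rank_one_decomposition {E : Type*} [AddCommMonoid E] [Module ℝ E] {p : E → ℝ}
    (hp : ∀ μ, 0 ≤ p μ) (hadd : ∀ μ ν, p (μ + ν) ≤ p μ + p ν)
    (hsmul : ∀ (c : ℝ) μ, p (c • μ) = |c| * p μ) {L : E →ₗ[ℝ] E} {f : E →ₗ[ℝ] ℝ}
    (hfL : ∀ μ, f (L μ) = f μ) {μ₀ : E} (hμ₀ : L μ₀ = μ₀) (hmass₀ : f μ₀ = 1)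
    (hfle : ∀ μ, |f μ| ≤ p μ) {ξ K : ℝ} (hξ : 0 < ξ) (hξ1 : ξ < 1) (hK : 0 < K)
    (hdecay : ∀ μ, f μ = 0 → ∀ n : ℕ, p ((L ^ n) μ) ≤ K * ξ ^ n * p μ) :
    ∃ P N : E →ₗ[ℝ] E, L = P + N ∧
      P ∘ₗ P = P ∧ Module.finrank ℝ (LinearMap.range P) = 1 ∧
      (∃ C : ℝ, ∀ μ, p (P μ) ≤ C * p μ) ∧ P ∘ₗ N = 0 ∧ N ∘ₗ P = 0 ∧
      ∃ ξ₁ K₂ : ℝ, 0 < ξ₁ ∧ ξ₁ < 1 ∧ 0 < K₂ ∧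
        ∀ (n : ℕ) (μ : E), p ((N ^ n) μ) ≤ p μ * ξ₁ ^ n * K₂ := by
  -- Subtraction comes from the scalar `-1`.
  let _ : AddCommGroup E := Module.addCommMonoidToAddCommGroup ℝ
  let P : E →ₗ[ℝ] E := f.smulRight μ₀
  have hPa : ∀ μ, P μ = f μ • μ₀ := fun μ => rfl
  have hPmass : ∀ μ, f (P μ) = f μ := fun μ => by
    rw [hPa, map_smul, hmass₀, smul_eq_mul, mul_one]
  have hPP : ∀ μ, P (P μ) = P μ := fun μ => by rw [hPa (P μ), hPmass, hPa]
  have hLP : ∀ μ, L (P μ) = P μ := fun μ => by rw [hPa, map_smul, hμ₀]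
  have hPL : ∀ μ, P (L μ) = P μ := fun μ => by rw [hPa, hfL, hPa]
  have hPle : ∀ μ : E, p (P μ) ≤ p μ₀ * p μ := fun μ => by
    rw [hPa, hsmul, mul_comm]
    exact mul_le_mul_of_nonneg_left (hfle μ) (hp _)
  have hNa : ∀ μ, (L - P) μ = L μ - P μ := fun μ => rfl
  -- The factor `1 + p μ₀` bounds `μ - P μ` in terms of `μ`. The summand 1 serves `n = 0`, where `N
  -- ^ 0` is the identity and not `1 - P`.
  refine ⟨P, L - P, by abel, LinearMap.ext hPP, ?_, ⟨_, hPle⟩, ?_, ?_, ξ,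
    K * (1 + p μ₀) + 1, hξ, hξ1, ?_, ?_⟩
  · have hrange : LinearMap.range P = Submodule.span ℝ {μ₀} := by
      refine le_antisymm ?_ ?_
      · rintro _ ⟨μ, rfl⟩
        exact Submodule.smul_mem _ _ (Submodule.mem_span_singleton_self _)
      · rw [Submodule.span_singleton_le_iff_mem]
        exact ⟨μ₀, by rw [hPa, hmass₀, one_smul]⟩
    rw [hrange]
    refine finrank_span_singleton fun h0 => ?_
    rw [h0, map_zero] at hmass₀
    exact zero_ne_one hmass₀
  · refine LinearMap.ext fun μ => ?_
    rw [LinearMap.comp_apply, hNa, map_sub, hPL, hPP, sub_self, LinearMap.zero_apply]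
  · refine LinearMap.ext fun μ => ?_
    rw [LinearMap.comp_apply, hNa, hLP, hPP, sub_self, LinearMap.zero_apply]
  · have := hp μ₀
    positivity
  · intro n μ
    have h0 := hp μ₀
    have hμ := hp μ
    -- `P` vanishes on `ker f`, which `L` preserves, so there the powers of `N` and `L` coincide.
    have hNL : ∀ (n : ℕ) (ν : E), f ν = 0 → ((L - P) ^ n) ν = (L ^ n) ν := by
      intro n
      induction n with
      | zero => exact fun _ _ => rfl
      | succ n ih =>
        intro ν hν
        rw [pow_succ, pow_succ, Module.End.mul_apply, Module.End.mul_apply, hNa, hPa, hν, zero_smul,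
          sub_zero, ih _ (by rw [hfL, hν])]
    rcases n with _ | n
    · change p μ ≤ _
      rw [pow_zero, mul_one]
      refine le_mul_of_one_le_right hμ ?_
      have : 0 ≤ K * (1 + p μ₀) := by positivity
      linarith
    · have hν : f (μ - P μ) = 0 := by rw [map_sub, hPmass, sub_self]
      have e : ((L - P) ^ (n + 1)) μ = (L ^ (n + 1)) (μ - P μ) := by
        rw [← hNL _ _ hν, map_sub]
        have : ((L - P) ^ (n + 1)) (P μ) = 0 := by
          rw [pow_succ, Module.End.mul_apply, hNa, hLP, hPP, sub_self, map_zero]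
        rw [this, sub_zero]
      have hsub : p (μ - P μ) ≤ (1 + p μ₀) * p μ := by
        have h1 := hadd μ ((-1 : ℝ) • P μ)
        rw [hsmul, abs_neg, abs_one, one_mul, neg_one_smul, ← sub_eq_add_neg] at h1
        linarith [hPle μ]
      rw [e]
      refine (hdecay _ hν (n + 1)).trans ?_
      calc K * ξ ^ (n + 1) * p (μ - P μ)
          ≤ K * ξ ^ (n + 1) * ((1 + p μ₀) * p μ) := by gcongr
        _ = p μ * ξ ^ (n + 1) * (K * (1 + p μ₀)) := by ring
        _ ≤ p μ * ξ ^ (n + 1) * (K * (1 + p μ₀) + 1) := by gcongr; linarith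

end RankOne

/-! ### The norm of `S^∞` and the total mass -/

section StrongNorm

variable {X Y : Type*} [MeasurableSpace X] [MetricSpace Y] [CompactSpace Y] [MeasurableSpace Y]
  [BorelSpace Y] [Nonempty Y] {m : Measure X} [IsFiniteMeasure m]
  {S : Type*} [NormedAddCommGroup S] [NormedSpace ℝ S] {ι : S →ₗ[ℝ] (X →₁[m] ℝ)}

/-- The marginal density of an element of `S^∞`, as an element of `S`. -/
noncomputable def density (μ : SInf Y ι) : S := μ.2.2.2.choose

lemma map_density (μ : SInf Y ι) : ι (density μ) = marginalDensity m (μ : SignedMeasure (X × Y)) :=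
  μ.2.2.2.choose_spec

/-- The leafwise norm of an element of `S^∞`, as a real number. -/
noncomputable def leafSup (μ : SInf Y ι) : ℝ := (lInfNorm m (μ : SignedMeasure (X × Y))).toReal

lemma leafSup_nonneg (μ : SInf Y ι) : 0 ≤ leafSup μ := ENNReal.toReal_nonneg

lemma ofReal_leafSup (μ : SInf Y ι) :
    ENNReal.ofReal (leafSup μ) = lInfNorm m (μ : SignedMeasure (X × Y)) :=
  ENNReal.ofReal_toReal μ.2.2.1.ne

lemma sInfNorm_eq (μ : SInf Y ι) : sInfNorm ι μ = ‖density μ‖ + leafSup μ := rfl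

lemma sInfNorm_nonneg (μ : SInf Y ι) : 0 ≤ sInfNorm ι μ :=
  add_nonneg (norm_nonneg _) (leafSup_nonneg μ)

lemma leafSup_add_le (μ ν : SInf Y ι) : leafSup (μ + ν) ≤ leafSup μ + leafSup ν := by
  unfold leafSup
  rw [← ENNReal.toReal_add μ.2.2.1.ne ν.2.2.1.ne]
  exact ENNReal.toReal_mono (ENNReal.add_lt_top.2 ⟨μ.2.2.1, ν.2.2.1⟩).ne
    (add_aux m μ.2.1 ν.2.1).2.1

lemma leafSup_smul (c : ℝ) (μ : SInf Y ι) : leafSup (c • μ) = |c| * leafSup μ := by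
  obtain ⟨k1, k2, -⟩ := smul_aux m ‖c‖₊ μ.2.1
  have h : lInfNorm m (c • (μ : SignedMeasure (X × Y))) =
      ‖c‖₊ * lInfNorm m (μ : SignedMeasure (X × Y)) := by
    rcases le_total 0 c with hc | hc
    · rw [← k2]; congr 2; simp [abs_of_nonneg hc]
    · rw [← k2, ← (neg_aux m k1).2.1]
      congr 1
      rw [coe_nnnorm, Real.norm_eq_abs, abs_of_nonpos hc]
      ext A hA
      simp
  unfold leafSup
  rw [Submodule.coe_smul, h, ENNReal.toReal_mul, ENNReal.coe_toReal, coe_nnnorm, Real.norm_eq_abs]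

variable (hι : Function.Injective ι)

lemma marginalDensity_smul (c : ℝ) {μ : SignedMeasure (X × Y)} (hμ : μ ∈ AB m)
    (hc : c • μ ∈ AB m) : marginalDensity m (c • μ) = c • marginalDensity m μ := by
  refine L1_ext_of_setIntegral_eq fun A hA => ?_
  rw [setIntegral_marginalDensity hc hA,
    integral_congr_ae (ae_restrict_of_ae (Lp.coeFn_smul c (marginalDensity m μ)))]
  simp only [Pi.smul_apply]
  rw [integral_smul, setIntegral_marginalDensity hμ hA]
  rfl

include hι

/-- The density in `S` is selected by choice; injectivity of `ι` makes it unique and therefore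
additive. -/
lemma density_add (μ ν : SInf Y ι) : density (μ + ν) = density μ + density ν := by
  refine hι ?_
  rw [map_add, map_density, map_density, map_density, Submodule.coe_add,
    (add_aux m μ.2.1 ν.2.1).2.2]

lemma density_smul (c : ℝ) (μ : SInf Y ι) : density (c • μ) = c • density μ := by
  refine hι ?_
  rw [map_smul, map_density, map_density, Submodule.coe_smul]
  exact marginalDensity_smul c μ.2.1 (c • μ).2.1

lemma sInfNorm_add_le (μ ν : SInf Y ι) : sInfNorm ι (μ + ν) ≤ sInfNorm ι μ + sInfNorm ι ν := by
  rw [sInfNorm_eq, sInfNorm_eq, sInfNorm_eq, density_add hι]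
  linarith [norm_add_le (density μ) (density ν), leafSup_add_le μ ν]

lemma sInfNorm_smul (c : ℝ) (μ : SInf Y ι) : sInfNorm ι (c • μ) = |c| * sInfNorm ι μ := by
  rw [sInfNorm_eq, sInfNorm_eq, density_smul hι, leafSup_smul, norm_smul, Real.norm_eq_abs, mul_add]

omit hι

/-- The total mass, as a linear functional on `S^∞`. -/
noncomputable def totalMass (ι : S →ₗ[ℝ] (X →₁[m] ℝ)) : SInf Y ι →ₗ[ℝ] ℝ where
  toFun μ := (μ : SignedMeasure (X × Y)) univ
  map_add' _ _ := rfl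
  map_smul' _ _ := rfl

lemma totalMass_apply (μ : SInf Y ι) : totalMass ι μ = (μ : SignedMeasure (X × Y)) univ := rfl

lemma massFunctional_density (μ : SInf Y ι) : massFunctional ι (density μ) = totalMass ι μ := by
  have h := setIntegral_marginalDensity μ.2.1 (A := univ) MeasurableSet.univ
  rw [massFunctional_apply, map_density, totalMass_apply]
  rwa [setIntegral_univ, univ_prod_univ] at h

/-! ### Iterates on `S^∞`: decay and fixed point -/

section Transfer

variable {T : X → X} {G : X × Y → Y} {PS : S →L[ℝ] S}

/-- `F^[n]` is itself a skew product over `T^[n]` that contracts by `α ^ n`, so the one-step bound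
applies to it directly. Iterating the one-step bound would produce powers of `M`. -/
lemma lInfNorm_map_iterate_le (hT : Measure.QuasiMeasurePreserving T m m) (hG : Measurable G)
    (hdiam : ∀ y₁ y₂ : Y, dist y₁ y₂ ≤ 1) {α : ℝ} (hα : 0 < α)
    (hcontr : ∀ x y₁ y₂, dist (G (x, y₁)) (G (x, y₂)) ≤ α * dist y₁ y₂) {M : ℝ}
    (hM : ∀ (n : ℕ) (A : Set X), MeasurableSet A → m.real (T^[n] ⁻¹' A) ≤ M * m.real A)
    {H : ℝ} (hH : 0 ≤ H) (hN : ∀ f, eLpNorm (ι f) ∞ m ≤ ENNReal.ofReal (H * ‖f‖)) (n : ℕ)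
    (μ : SInf Y ι) :
    lInfNorm m (VectorMeasure.map (μ : SignedMeasure (X × Y)) (skewProduct T G)^[n]) ≤
      ENNReal.ofReal ((α ^ n * leafSup μ + H * ‖density μ‖) * M) := by
  rw [iterate_skewProduct]
  refine lInfNorm_map_le (hT.iterate n)
    (measurable_snd.comp ((measurable_skewProduct hT.measurable hG).iterate n)) hdiam
    (pow_pos hα n) (dist_iterate_skewProduct_le T hα hcontr n) (hM n) μ.2.1 (leafSup_nonneg μ)
    (by positivity) (ofReal_leafSup μ).ge ?_
  rw [← map_density]
  exact ae_abs_le_of_dominatesLInf hH hN _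

lemma map_mem_SInf (hT : Measure.QuasiMeasurePreserving T m m) (hG : Measurable G)
    (hdiam : ∀ y₁ y₂ : Y, dist y₁ y₂ ≤ 1) {α : ℝ} (hα : 0 < α)
    (hcontr : ∀ x y₁ y₂, dist (G (x, y₁)) (G (x, y₂)) ≤ α * dist y₁ y₂) {M : ℝ}
    (hM : ∀ (n : ℕ) (A : Set X), MeasurableSet A → m.real (T^[n] ⁻¹' A) ≤ M * m.real A)
    {H : ℝ} (hH : 0 ≤ H) (hN : ∀ f, eLpNorm (ι f) ∞ m ≤ ENNReal.ofReal (H * ‖f‖))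
    (hS : IsStrongSpace T ι PS) (μ : SignedMeasure (X × Y)) (hμ : μ ∈ SInf Y ι) :
    VectorMeasure.map μ (skewProduct T G) ∈ SInf Y ι := by
  refine ⟨map_mem_AB hT hG hμ.1, ?_, PS (density ⟨μ, hμ⟩), ?_⟩
  · exact (lInfNorm_map_iterate_le hT hG hdiam hα hcontr hM hH hN 1 ⟨μ, hμ⟩).trans_lt
      ENNReal.ofReal_lt_top
  · rw [hS.invariant, map_density, marginalDensity_map hT hG hμ.1]

variable {L : SInf Y ι →ₗ[ℝ] SInf Y ι}

lemma coe_pow_apply (hF : Measurable (skewProduct T G))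
    (hL : ∀ μ, (L μ : SignedMeasure (X × Y)) =
      VectorMeasure.map (μ : SignedMeasure (X × Y)) (skewProduct T G)) (n : ℕ) (μ : SInf Y ι) :
    ((L ^ n) μ : SignedMeasure (X × Y)) =
      VectorMeasure.map (μ : SignedMeasure (X × Y)) (skewProduct T G)^[n] := by
  induction n with
  | zero => exact (VectorMeasure.map_id _).symm
  | succ n ih =>
    rw [pow_succ', Module.End.mul_apply, hL, ih, map_map_signedMeasure (hF.iterate n) hF,
      Function.iterate_succ']

lemma density_pow_apply (hT : Measure.QuasiMeasurePreserving T m m) (hG : Measurable G)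
    (hS : IsStrongSpace T ι PS)
    (hL : ∀ μ, (L μ : SignedMeasure (X × Y)) =
      VectorMeasure.map (μ : SignedMeasure (X × Y)) (skewProduct T G)) (n : ℕ) (μ : SInf Y ι) :
    density ((L ^ n) μ) = (PS ^ n) (density μ) := by
  induction n with
  | zero => rfl
  | succ n ih =>
    have e : (PS ^ (n + 1)) (density μ) = PS ((PS ^ n) (density μ)) := by rw [pow_succ']; rfl
    refine hS.injective ?_
    rw [e, hS.invariant, ← ih, map_density, map_density, pow_succ', Module.End.mul_apply, hL,
      marginalDensity_map hT hG ((L ^ n) μ).2.1]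

lemma totalMass_map (hF : Measurable (skewProduct T G))
    (hL : ∀ μ, (L μ : SignedMeasure (X × Y)) =
      VectorMeasure.map (μ : SignedMeasure (X × Y)) (skewProduct T G)) (μ : SInf Y ι) :
    totalMass ι (L μ) = totalMass ι μ := by
  rw [totalMass_apply, hL, VectorMeasure.map_apply _ hF MeasurableSet.univ]
  rfl

/-- Convergence to equilibrium: measures of zero total mass decay exponentially. -/
lemma exists_decay_of_totalMass_eq_zero (hT : Measure.QuasiMeasurePreserving T m m)
    (hG : Measurable G) (hdiam : ∀ y₁ y₂ : Y, dist y₁ y₂ ≤ 1) {α : ℝ} (hα : 0 < α) (hα1 : α < 1)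
    (hcontr : ∀ x y₁ y₂, dist (G (x, y₁)) (G (x, y₂)) ≤ α * dist y₁ y₂) {M : ℝ} (hM0 : 0 < M)
    (hM : ∀ (n : ℕ) (A : Set X), MeasurableSet A → m.real (T^[n] ⁻¹' A) ≤ M * m.real A)
    {H : ℝ} (hH : 0 ≤ H) (hN : ∀ f, eLpNorm (ι f) ∞ m ≤ ENNReal.ofReal (H * ‖f‖))
    (hS : IsStrongSpace T ι PS) {D r : ℝ} (hD : 0 < D) (hr : 0 < r) (hr1 : r < 1)
    (hgap : ∀ f, massFunctional ι f = 0 → ∀ n : ℕ, ‖(PS ^ n) f‖ ≤ D * r ^ n * ‖f‖)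
    (hL : ∀ μ, (L μ : SignedMeasure (X × Y)) =
      VectorMeasure.map (μ : SignedMeasure (X × Y)) (skewProduct T G)) :
    ∃ ξ K : ℝ, 0 < ξ ∧ ξ < 1 ∧ 0 < K ∧ ∀ μ : SInf Y ι, totalMass ι μ = 0 →
      ∀ n : ℕ, sInfNorm ι ((L ^ n) μ) ≤ K * ξ ^ n * sInfNorm ι μ := by
  have hF := measurable_skewProduct hT.measurable hG
  have hsup : ∀ (n : ℕ) (μ : SInf Y ι),
      leafSup ((L ^ n) μ) ≤ (α ^ n * leafSup μ + H * ‖density μ‖) * M := by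
    intro n μ
    have h := lInfNorm_map_iterate_le hT hG hdiam hα hcontr hM hH hN n μ
    rw [← coe_pow_apply hF hL, ← ofReal_leafSup] at h
    have := leafSup_nonneg μ
    exact (ENNReal.ofReal_le_ofReal_iff (by positivity)).1 h
  set s := max α r with hs
  have hs0 : 0 < s := lt_max_of_lt_left hα
  have hs1 : s < 1 := max_lt hα1 hr1
  set ξ := √s with hξ
  have hξ0 : 0 < ξ := Real.sqrt_pos.2 hs0
  have hξ1 : ξ < 1 := by
    rw [hξ, Real.sqrt_lt' one_pos, one_pow]; exact hs1
  set K := M * (M * (1 + H) + H * D) + D with hK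
  have hK0 : 0 < K := by positivity
  refine ⟨ξ, K / ξ, hξ0, hξ1, by positivity, fun μ hμ n => ?_⟩
  -- During the first `k` steps the density decays while the leafwise norm stays bounded; during the
  -- last `j` steps the leafwise norm contracts and the density contributes only its small value.
  set k := n / 2 with hk
  set j := n - k with hj
  have hn : n = j + k := by omega
  have hjk : k ≤ j := by omega
  have ha := leafSup_nonneg μ
  have hd := norm_nonneg (density μ)
  have hmass : massFunctional ι (density μ) = 0 := by rw [massFunctional_density, hμ]
  have hαk : α ^ j ≤ s ^ k :=
    (pow_le_pow_of_le_one hα.le hα1.le hjk).trans (pow_le_pow_left₀ hα.le (le_max_left _ _) k)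
  have hrk : r ^ k ≤ s ^ k := pow_le_pow_left₀ hr.le (le_max_right _ _) k
  have hrn : r ^ n ≤ s ^ k := (pow_le_pow_of_le_one hr.le hr1.le (by omega)).trans hrk
  have h1 : leafSup ((L ^ k) μ) ≤ (leafSup μ + H * ‖density μ‖) * M := by
    refine (hsup k μ).trans ?_
    gcongr
    exact mul_le_of_le_one_left ha (pow_le_one₀ hα.le hα1.le)
  have h2 : ‖density ((L ^ k) μ)‖ ≤ D * s ^ k * ‖density μ‖ := by
    rw [density_pow_apply hT hG hS hL]
    refine (hgap _ hmass k).trans ?_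
    gcongr
  have h3 : leafSup ((L ^ n) μ) ≤
      s ^ k * (M * (M * (leafSup μ + H * ‖density μ‖) + H * D * ‖density μ‖)) := by
    have e : (L ^ n) μ = (L ^ j) ((L ^ k) μ) := by rw [hn, pow_add]; rfl
    rw [e]
    calc leafSup ((L ^ j) ((L ^ k) μ))
        ≤ (α ^ j * leafSup ((L ^ k) μ) + H * ‖density ((L ^ k) μ)‖) * M := hsup j _
      _ ≤ (s ^ k * ((leafSup μ + H * ‖density μ‖) * M) + H * (D * s ^ k * ‖density μ‖)) * M := by
        have := leafSup_nonneg ((L ^ k) μ)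
        gcongr
      _ = _ := by ring
  have h4 : ‖density ((L ^ n) μ)‖ ≤ s ^ k * (D * ‖density μ‖) := by
    rw [density_pow_apply hT hG hS hL]
    refine (hgap _ hmass n).trans ?_
    calc D * r ^ n * ‖density μ‖ ≤ D * s ^ k * ‖density μ‖ := by gcongr
      _ = _ := by ring
  -- Here `s = ξ ^ 2` and `n ≤ 2 * k + 1`; the division by `ξ` pays for odd `n`.
  have h5 : s ^ k ≤ ξ ^ n / ξ := by
    rw [le_div_iff₀ hξ0, ← Real.sq_sqrt hs0.le, ← hξ, ← pow_mul, ← pow_succ]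
    exact pow_le_pow_of_le_one hξ0.le hξ1.le (by omega)
  calc sInfNorm ι ((L ^ n) μ) = ‖density ((L ^ n) μ)‖ + leafSup ((L ^ n) μ) := rfl
    _ ≤ s ^ k * (D * ‖density μ‖) +
        s ^ k * (M * (M * (leafSup μ + H * ‖density μ‖) + H * D * ‖density μ‖)) :=
      add_le_add h4 h3
    _ = s ^ k * (D * ‖density μ‖ +
        M * (M * (leafSup μ + H * ‖density μ‖) + H * D * ‖density μ‖)) := by ring
    _ ≤ s ^ k * (K * (‖density μ‖ + leafSup μ)) := by
      refine mul_le_mul_of_nonneg_left ?_ (by positivity)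
      have e : K * (‖density μ‖ + leafSup μ) - (D * ‖density μ‖ +
        M * (M * (leafSup μ + H * ‖density μ‖) + H * D * ‖density μ‖)) =
        M * M * ‖density μ‖ + (M * M * H + M * H * D + D) * leafSup μ := by rw [hK]; ring
      have : 0 ≤ M * M * ‖density μ‖ + (M * M * H + M * H * D + D) * leafSup μ := by positivity
      linarith
    _ ≤ ξ ^ n / ξ * (K * (‖density μ‖ + leafSup μ)) := by gcongr
    _ = K / ξ * ξ ^ n * sInfNorm ι μ := by rw [sInfNorm_eq]; ring

/-- There is an invariant probability measure in `S^∞`. -/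
lemma exists_fixed_point (hT : Measure.QuasiMeasurePreserving T m m) (hG : Measurable G)
    (hdiam : ∀ y₁ y₂ : Y, dist y₁ y₂ ≤ 1) {α : ℝ} (hα : 0 < α) (hα1 : α < 1)
    (hcontr : ∀ x y₁ y₂, dist (G (x, y₁)) (G (x, y₂)) ≤ α * dist y₁ y₂)
    {H : ℝ} (hH : 0 ≤ H) (hN : ∀ f, eLpNorm (ι f) ∞ m ≤ ENNReal.ofReal (H * ‖f‖))
    (hS : IsStrongSpace T ι PS)
    (hL : ∀ μ, (L μ : SignedMeasure (X × Y)) =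
      VectorMeasure.map (μ : SignedMeasure (X × Y)) (skewProduct T G)) :
    ∃ μ₀ : SInf Y ι, L μ₀ = μ₀ ∧ totalMass ι μ₀ = 1 := by
  have hF := measurable_skewProduct hT.measurable hG
  obtain ⟨ψ₀, ⟨⟨hd0, hd1⟩, hinv⟩, -, -⟩ := hS.equilibrium
  set l := m.withDensity fun x => ENNReal.ofReal (ι ψ₀ x) with hl
  have hi := L1.integrable_coeFn (ι ψ₀)
  have hlf : IsFiniteMeasure l := isFiniteMeasure_withDensity_ofReal hi.2
  have hlA : ∀ A, MeasurableSet A → l A = ENNReal.ofReal (∫ x in A, ι ψ₀ x ∂m) := fun A hA => by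
    rw [hl, withDensity_apply _ hA, ofReal_integral_eq_lintegral_ofReal hi.integrableOn
      (ae_restrict_of_ae hd0)]
  have hlr : ∀ A, MeasurableSet A → l.real A = ∫ x in A, ι ψ₀ x ∂m := fun A hA => by
    rw [Measure.real, hlA A hA, ENNReal.toReal_ofReal]
    exact integral_nonneg_of_ae (ae_restrict_of_ae hd0)
  -- Invariance of `ψ₀` under the Perron–Frobenius operator says that its integrals over `A` and
  -- `T⁻¹A` agree.
  have hTl : MeasurePreserving T l l := by
    refine ⟨hT.measurable, Measure.ext fun A hA => ?_⟩
    have := setIntegral_pow hT hS 1 ψ₀ hA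
    rw [pow_one, hinv, Function.iterate_one] at this
    rw [Measure.map_apply hT.measurable hA, hlA _ (hT.measurable hA), hlA A hA, this]
  obtain ⟨ρ, hρf, hρ1, hρF⟩ := exists_invariant_measure hTl hG hdiam hα hα1 hcontr
  have hρm : ρ.fst ≪ m := by rw [hρ1]; exact withDensity_absolutelyContinuous _ _
  have hρA : ∀ A, MeasurableSet A → ρ.real (A ×ˢ univ) = ∫ x in A, ι ψ₀ x ∂m := fun A hA => by
    rw [← hlr A hA, ← hρ1, Measure.real, Measure.real, Measure.fst_apply hA, prod_univ]
  have hrep : ρ.toSignedMeasure = ρ.toSignedMeasure - (0 : Measure (X × Y)).toSignedMeasure := by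
    rw [Measure.toSignedMeasure_zero, sub_zero]
  have h0m : (0 : Measure (X × Y)).fst ≪ m := by
    rw [Measure.fst_zero]; exact Measure.AbsolutelyContinuous.zero _
  obtain ⟨hAB, hleaf, -⟩ := repr_aux m hrep hρm h0m
  have hb := ae_abs_le_of_dominatesLInf hH hN ψ₀
  -- `ρ` is positive, so its leafwise norm is at most the mass of the leaf restriction, which is
  -- `ψ₀` and hence essentially bounded.
  have hsup : lInfNorm m ρ.toSignedMeasure ≤ ENNReal.ofReal (H * ‖ψ₀‖) := by
    refine essSup_le_of_ae_le _ ?_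
    have key := ae_wDist_leafRestrict_le hρm h0m (c := H * ‖ψ₀‖) fun g hg A hA => by
      rw [Measure.restrict_zero, integral_zero_measure, sub_zero]
      have h1 := norm_setIntegral_le_of_norm_le_const (μ := ρ) (s := A ×ˢ univ)
        (f := fun z : X × Y => g z.2) (C := 1) (measure_lt_top _ _) fun z _ => hg.2 z.2
      rw [one_mul, hρA A hA] at h1
      refine h1.trans ((le_abs_self _).trans ?_)
      rw [← Real.norm_eq_abs]
      exact norm_setIntegral_le_of_norm_le_const_ae (measure_lt_top m A) (ae_restrict_of_ae hb)
    filter_upwards [hleaf, key] with x h1 h2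
    rwa [h1]
  have hdens : ι ψ₀ = marginalDensity m ρ.toSignedMeasure := by
    refine L1_ext_of_setIntegral_eq fun A hA => ?_
    rw [setIntegral_marginalDensity hAB hA,
      Measure.toSignedMeasure_apply_measurable (hA.prod MeasurableSet.univ), hρA A hA]
  refine ⟨⟨ρ.toSignedMeasure, hAB, hsup.trans_lt ENNReal.ofReal_lt_top, ψ₀, hdens⟩, ?_, ?_⟩
  · refine Subtype.ext ?_
    rw [hL]
    change VectorMeasure.map ρ.toSignedMeasure (skewProduct T G) = ρ.toSignedMeasure
    ext A hA
    rw [VectorMeasure.map_apply _ hF hA, Measure.toSignedMeasure_apply_measurable (hF hA),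
      Measure.toSignedMeasure_apply_measurable hA, ← map_measureReal_apply hF hA, hρF]
  · change ρ.toSignedMeasure univ = 1
    have h1 := norm_eq_massFunctional hd0
    rw [Measure.toSignedMeasure_apply_measurable MeasurableSet.univ, ← univ_prod_univ,
      hρA _ MeasurableSet.univ, setIntegral_univ, ← hd1, h1, massFunctional_apply]

end Transfer

/-- **Spectral gap** of the transfer operator of a fibre-contracting skew product on `S^∞`. -/
theorem exists_spectral_decomposition [CompleteSpace S] {T : X → X} {G : X × Y → Y}
    {PS : S →L[ℝ] S} (hT : Measure.QuasiMeasurePreserving T m m) (hG : Measurable G)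
    (hdiam : ∀ y₁ y₂ : Y, dist y₁ y₂ ≤ 1) (hcontr : ContractsLeaves G)
    (hS : IsStrongSpace T ι PS) (hone : ∃ e : S, (ι e : X → ℝ) =ᵐ[m] fun _ => 1)
    (hN : DominatesLInf ι) :
    ∃ L : SInf Y ι →ₗ[ℝ] SInf Y ι,
      (∀ μ, (L μ : SignedMeasure (X × Y)) =
        VectorMeasure.map (μ : SignedMeasure (X × Y)) (skewProduct T G)) ∧
      ∃ P N : SInf Y ι →ₗ[ℝ] SInf Y ι,
        L = P + N ∧
        P ∘ₗ P = P ∧ Module.finrank ℝ (LinearMap.range P) = 1 ∧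
        (∃ C : ℝ, ∀ μ, sInfNorm ι (P μ) ≤ C * sInfNorm ι μ) ∧
        P ∘ₗ N = 0 ∧ N ∘ₗ P = 0 ∧
        ∃ ξ₁ K₂ : ℝ, 0 < ξ₁ ∧ ξ₁ < 1 ∧ 0 < K₂ ∧
          ∀ (n : ℕ) (μ : SInf Y ι), sInfNorm ι ((N ^ n) μ) ≤ sInfNorm ι μ * ξ₁ ^ n * K₂ := by
  have hF := measurable_skewProduct hT.measurable hG
  obtain ⟨⟨B, hB⟩, D, r, hD, hr, hr1, hgap⟩ := exists_spectralGap hT hS hN hone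
  obtain ⟨M, hM0, hM⟩ := exists_measureReal_preimage_iterate_le hT hS hN hone hB
  obtain ⟨H, hH, hN⟩ := hN
  obtain ⟨α, hα, hα1, hcontr⟩ := hcontr
  let L : SInf Y ι →ₗ[ℝ] SInf Y ι :=
    (VectorMeasure.mapₗ (R := ℝ) (M := ℝ) (skewProduct T G)).restrict
      (map_mem_SInf hT hG hdiam hα hcontr hM hH hN hS)
  have hL : ∀ μ, (L μ : SignedMeasure (X × Y)) =
      VectorMeasure.map (μ : SignedMeasure (X × Y)) (skewProduct T G) := fun μ => rfl
  obtain ⟨μ₀, hμ₀, hmass₀⟩ := exists_fixed_point hT hG hdiam hα hα1 hcontr hH hN hS hL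
  obtain ⟨ξ, K, hξ, hξ1, hK, hdecay⟩ := exists_decay_of_totalMass_eq_zero hT hG hdiam hα hα1 hcontr
    hM0 hM hH hN hS hD hr hr1 hgap hL
  have hfle : ∀ μ : SInf Y ι, |totalMass ι μ| ≤ sInfNorm ι μ := fun μ => by
    rw [← massFunctional_density]
    exact (abs_massFunctional_le hS _).trans (le_add_of_nonneg_right (leafSup_nonneg μ))
  exact ⟨L, hL, exists_rank_one_decomposition sInfNorm_nonneg (sInfNorm_add_le hS.injective)
    (sInfNorm_smul hS.injective) (totalMass_map hF hL) hμ₀ hmass₀ hfle hξ hξ1 hK hdecay⟩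

end StrongNorm

end SkewProduct

theorem theorem6p2
    -- the compact Riemannian manifolds `N₁` and `N₂` (possibly with boundary), `diam N₂ = 1`
    {d₁ : ℕ} {H₁ : Type*} [TopologicalSpace H₁]
    (I₁ : ModelWithCorners ℝ (EuclideanSpace ℝ (Fin d₁)) H₁)
    {N₁ : Type*} [TopologicalSpace N₁] [T2Space N₁] [CompactSpace N₁] [ChartedSpace H₁ N₁]
    [IsManifold I₁ ∞ N₁] [RiemannianBundle (fun x : N₁ => TangentSpace I₁ x)]
    [IsContMDiffRiemannianBundle I₁ ∞ (EuclideanSpace ℝ (Fin d₁))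
      (fun x : N₁ => TangentSpace I₁ x)]
    [MeasurableSpace N₁] [BorelSpace N₁]
    {d₂ : ℕ} {H₂ : Type*} [TopologicalSpace H₂]
    (I₂ : ModelWithCorners ℝ (EuclideanSpace ℝ (Fin d₂)) H₂)
    {N₂ : Type*} [MetricSpace N₂] [CompactSpace N₂] [Nonempty N₂] [ChartedSpace H₂ N₂]
    [IsManifold I₂ ∞ N₂] [RiemannianBundle (fun x : N₂ => TangentSpace I₂ x)]
    [IsContMDiffRiemannianBundle I₂ ∞ (EuclideanSpace ℝ (Fin d₂))
      (fun x : N₂ => TangentSpace I₂ x)]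
    [IsRiemannianManifold I₂ N₂] [MeasurableSpace N₂] [BorelSpace N₂]
    (hdiam : Metric.diam (univ : Set N₂) = 1)
    -- the skew product `F(x, y) = (T(x), G(x, y))`, contracting the leaves
    (T : N₁ → N₁) (G : N₁ × N₂ → N₂) (hG : Measurable G) (hcontr : ContractsLeaves G)
    -- the base map is non-singular and piecewise a diffeomorphism
    (hT : Measure.QuasiMeasurePreserving T (normalizedVolume I₁ N₁) (normalizedVolume I₁ N₁))
    (hpw : IsPiecewiseDiffeo I₁ (normalizedVolume I₁ N₁) T)
    -- the Banach space of densities on the base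
    {S : Type*} [NormedAddCommGroup S] [NormedSpace ℝ S] [CompleteSpace S]
    (ι : S →ₗ[ℝ] (N₁ →₁[normalizedVolume I₁ N₁] ℝ)) (PS : S →L[ℝ] S)
    (hS : IsStrongSpace T ι PS)
    (hone : ∃ e : S, (ι e : N₁ → ℝ) =ᵐ[normalizedVolume I₁ N₁] fun _ => 1)
    (hN : DominatesLInf ι) :
    ∃ L : SInf N₂ ι →ₗ[ℝ] SInf N₂ ι,
      (∀ μ, (L μ : SignedMeasure (N₁ × N₂)) =
        VectorMeasure.map (μ : SignedMeasure (N₁ × N₂)) (skewProduct T G)) ∧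
      ∃ P N : SInf N₂ ι →ₗ[ℝ] SInf N₂ ι,
        L = P + N ∧
        P ∘ₗ P = P ∧ Module.finrank ℝ (LinearMap.range P) = 1 ∧
        (∃ C : ℝ, ∀ μ, sInfNorm ι (P μ) ≤ C * sInfNorm ι μ) ∧
        P ∘ₗ N = 0 ∧ N ∘ₗ P = 0 ∧
        ∃ ξ₁ K₂ : ℝ, 0 < ξ₁ ∧ ξ₁ < 1 ∧ 0 < K₂ ∧
          ∀ (n : ℕ) (μ : SInf N₂ ι), sInfNorm ι ((N ^ n) μ) ≤ sInfNorm ι μ * ξ₁ ^ n * K₂ := by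
  have hd : ∀ y₁ y₂ : N₂, dist y₁ y₂ ≤ 1 := fun y₁ y₂ => by
    rw [← hdiam]
    exact Metric.dist_le_diam_of_mem isCompact_univ.isBounded (mem_univ _) (mem_univ _)
  exact exists_spectral_decomposition hT hG hd hcontr hS hone hN
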